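/- Let $D\subset\mathbb R^2$ be a bounded, simply connected (nonempty, connected) open set and $\omega>0$. For scalar $\psi$ put $\nabla\times\psi=(\partial_2\psi,-\partial_1\psi)$, and for a vector field $E$ put $\operatorname{curl}E=\partial_1E_2-\partial_2E_1$; derivatives are weak, functions are complex valued, $H^1_0(D)$ is the closure of $C_c^\infty(D)$ in $H^1(D)$, and $H_0(\operatorname{curl},D)$, $H_0(\operatorname{div},D)$ are the spaces of $E\in L^2(D)^2$ with $\operatorname{curl}E\in L^2(D)$, respectively $\operatorname{div}E\in L^2(D)$, whose tangential, respectively normal, trace vanishes in the sense of Green's formula against all of $H^1(D)$. Consider the electric eigenproblem: for $\beta^2\in\mathbb C$ find $E\in H_0(\operatorname{curl},D)$ with $\operatorname{curl}E\in H^1(D)$, $\operatorname{div}E\in H^1_0(D)$ and $$\nabla\times\operatorname{curl}E-\omega^2E-\nabla\operatorname{div}E=-\beta^2E,$$ and the magnetic eigenproblem: for $\beta^2\in\mathbb C$ find $H\in H(\operatorname{curl},D)\cap H_0(\operatorname{div},D)$ with $\operatorname{curl}H\in H^1_0(D)$, $\operatorname{div}H\in H^1(D)$ and $$\nabla\times\operatorname{curl}H-\omega^2H-\nabla\operatorname{div}H=-\beta^2H.$$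 For real $\lambda,\mu$ let $V^{\rm Dir}_\lambda\subset H^1_0(D)$ and $V^{\rm Neu}_\mu\subset H^1(D)$ be the (weak) Dirichlet and Neumann eigenspaces of $-\Delta$ on $D$; $\lambda$ is a Dirichlet eigenvalue if $V^{\rm Dir}_\lambda\ne0$, and $\mu$ is a Neumann eigenvalue if $V^{\rm Neu}_\mu\neq0$. Multiplicity means the dimension of the eigenspace over $\mathbb C$. Electric problem. The eigenvalues $\beta^2$ are exactly the numbers $\omega^2-\mu$ with $\mu>0$ a Neumann eigenvalue and the numbers $\omega^2-\lambda$ with $\lambda$ a Dirichlet eigenvalue. Moreover: (a) If $\mu>0$ is a Neumann but not a Dirichlet eigenvalue, the eigenspace for $\beta^2=\omega^2-\mu$ is $\{\nabla\times\psi:\psi\in V^{\rm Neu}_\mu\}$, and the multiplicity of $\beta^2$ equals that of $\mu$. (b) If $\lambda$ is a Dirichlet but not a Neumann eigenvalue, the eigenspace for $\beta^2=\omega^2-\lambda$ is $\{\nabla\phi:\phi\in V^{\rm Dir}_\lambda\}$, and the multiplicity of $\beta^2$ equals that of $\lambda$. (c) If $\mu=\lambda$ is both a Neumann and a Dirichlet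 eigenvalue, the eigenspace for $\beta^2=\omega^2-\mu=\omega^2-\lambda$ is $\{\nabla\times\psi+\nabla\phi:\psi\in V^{\rm Neu}_\mu,\ \phi\in V^{\rm Dir}_\lambda\}$, and the multiplicity of $\beta^2$ is the sum of the multiplicities of $\mu$ and $\lambda$. Magnetic problem. The eigenvalues $\beta^2$ are the same numbers, and (a), (b), (c) hold with $\nabla\times$ and $\nabla$ interchanged: the eigenspaces are $\{\nabla\psi\}$ in case (a), $\{\nabla\times\phi\}$ in case (b) and $\{\nabla\psi+\nabla\times\phi\}$ in case (c), with the same multiplicities. -/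

import Mathlib

open MeasureTheory TopologicalSpace
open scoped Distributions LineDeriv

noncomputable section

namespace Waveguide

/-- The Euclidean plane `ℝ²`. -/
abbrev Plane : Type := EuclideanSpace ℝ (Fin 2)

/-- The complex Lebesgue space `L²(D)`. -/
abbrev L2 (D : Opens Plane) : Type := Lp ℂ 2 (volume.restrict (D : Set Plane))

/-- Vector fields in `L²(D)²`; the coordinates `x₁, x₂` have the indices `0, 1`. -/
abbrev VecL2 (D : Opens Plane) : Type := Fin 2 → L2 D

/-- The coordinate directions. -/
def dir (i : Fin 2) : Plane := EuclideanSpace.single i (1 : ℝ)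

theorem testFunction_memLp (D : Opens Plane) (χ : 𝓓(D, ℂ)) :
    MemLp (χ : Plane → ℂ) 2 (volume.restrict (D : Set Plane)) :=
  χ.continuous.memLp_of_hasCompactSupport χ.hasCompactSupport

/-- The inclusion of the test functions `C_c^∞(D)` in `L²(D)`. -/
def testToL2 (D : Opens Plane) : 𝓓(D, ℂ) →ₗ[ℂ] L2 D where
  toFun χ := (testFunction_memLp D χ).toLp χ
  map_add' _ _ := rfl
  map_smul' _ _ := rfl

/-- `g = ∂ᵢ u` in the sense of distributions on `D`: `∫_D u ∂ᵢχ̄ = - ∫_D g χ̄` for every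
test function `χ` (Mathlib's `inner ℂ f h` on `L²` is `∫ f̄ h`; the conjugate of a test
function is a test function). -/
def IsWeakPartial (D : Opens Plane) (i : Fin 2) (u g : L2 D) : Prop :=
  ∀ χ : 𝓓(D, ℂ), inner ℂ (testToL2 D (∂_{dir i} χ)) u = -inner ℂ (testToL2 D χ) g

/-- An element of `L²(D)` that is orthogonal to all test functions vanishes. -/
theorem eq_zero_of_inner_test (D : Opens Plane) (g : L2 D)
    (h : ∀ χ : 𝓓(D, ℂ), inner ℂ (testToL2 D χ) g = 0) : g = 0 := by
  have hloc : LocallyIntegrableOn (g : Plane → ℂ) (D : Set Plane) volume := by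
    rw [locallyIntegrableOn_iff D.isOpen.isLocallyClosed]
    intro K hKD hK
    have h1 : MemLp (g : Plane → ℂ) 2 (volume.restrict K) :=
      (Lp.memLp g).mono_measure (Measure.restrict_mono_set volume hKD)
    have : IsFiniteMeasure (volume.restrict K) := ⟨by
      simpa using hK.measure_lt_top⟩
    exact h1.integrable (by norm_num)
  have hae : ∀ᵐ x ∂(volume : Measure Plane), x ∈ (D : Set Plane) → (g : Plane → ℂ) x = 0 := by
    refine D.isOpen.ae_eq_zero_of_integral_contDiff_smul_eq_zero hloc ?_
    intro f hf hfc hfs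
    have hsupp : Function.support (fun x => (f x : ℂ)) = Function.support f := by
      ext x
      simp
    let χ : 𝓓(D, ℂ) :=
      { toFun := fun x => (f x : ℂ)
        contDiff' := Complex.ofRealCLM.contDiff.comp hf
        hasCompactSupport' := by
          unfold HasCompactSupport tsupport
          rw [hsupp]
          exact hfc
        tsupport_subset' := by
          unfold tsupport
          rw [hsupp]
          exact hfs }
    have hχ := h χ
    rw [L2.inner_def] at hχ
    have hcongr : ∫ x in (D : Set Plane), f x • (g : Plane → ℂ) x
        = ∫ x in (D : Set Plane), inner ℂ ((testToL2 D χ : L2 D) x) ((g : Plane → ℂ) x) := by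
      refine integral_congr_ae ?_
      filter_upwards [(testFunction_memLp D χ).coeFn_toLp] with x hx
      have hx' : (testToL2 D χ : L2 D) x = (f x : ℂ) := hx
      rw [hx']
      simp [mul_comm]
    have hset : ∫ x in (D : Set Plane), f x • (g : Plane → ℂ) x
        = ∫ x, f x • (g : Plane → ℂ) x := by
      refine setIntegral_eq_integral_of_forall_compl_eq_zero ?_
      intro x hx
      have : f x = 0 := by
        by_contra hne
        exact hx (hfs (subset_tsupport f hne))
      simp [this]
    rw [← hset, hcongr]
    exact hχ
  refine Lp.ext ?_
  have h0 := Lp.coeFn_zero ℂ 2 (volume.restrict (D : Set Plane))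
  have h1 := (ae_restrict_iff' D.isOpen.measurableSet).2 hae
  filter_upwards [h0, h1] with x hx0 hx1
  rw [hx0, hx1]
  rfl

theorem IsWeakPartial.unique {D : Opens Plane} {i : Fin 2} {u g g' : L2 D}
    (h : IsWeakPartial D i u g) (h' : IsWeakPartial D i u g') : g = g' := by
  refine sub_eq_zero.1 (eq_zero_of_inner_test D _ fun χ => ?_)
  have := (h χ).symm.trans (h' χ)
  rw [inner_sub_right]
  linear_combination -this

theorem IsWeakPartial.add {D : Opens Plane} {i : Fin 2} {u u' g g' : L2 D}
    (h : IsWeakPartial D i u g) (h' : IsWeakPartial D i u' g') :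
    IsWeakPartial D i (u + u') (g + g') := fun χ => by
  rw [inner_add_right, inner_add_right, h χ, h' χ]
  ring

theorem IsWeakPartial.smul {D : Opens Plane} {i : Fin 2} {u g : L2 D} (a : ℂ)
    (h : IsWeakPartial D i u g) : IsWeakPartial D i (a • u) (a • g) := fun χ => by
  rw [inner_smul_right, inner_smul_right, h χ]
  ring

theorem IsWeakPartial.zero (D : Opens Plane) (i : Fin 2) :
    IsWeakPartial D i (0 : L2 D) 0 := fun χ => by
  simp

/-- The Sobolev space `H¹(D)`: functions in `L²(D)` with weak first derivatives in `L²(D)`. -/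
def H1 (D : Opens Plane) : Submodule ℂ (L2 D) where
  carrier := {u | ∀ i, ∃ g, IsWeakPartial D i u g}
  zero_mem' i := ⟨0, IsWeakPartial.zero D i⟩
  add_mem' hu hv i := ⟨_, (hu i).choose_spec.add (hv i).choose_spec⟩
  smul_mem' a _ hu i := ⟨_, (hu i).choose_spec.smul a⟩

/-- The weak derivative `∂ᵢ : H¹(D) → L²(D)`. -/
def weakPartial (D : Opens Plane) (i : Fin 2) : H1 D →ₗ[ℂ] L2 D where
  toFun u := (u.2 i).choose
  map_add' u v :=
    ((u + v).2 i).choose_spec.unique ((u.2 i).choose_spec.add (v.2 i).choose_spec)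
  map_smul' a u := ((a • u).2 i).choose_spec.unique ((u.2 i).choose_spec.smul a)

theorem weakPartial_spec (D : Opens Plane) (i : Fin 2) (u : H1 D) :
    IsWeakPartial D i (u : L2 D) (weakPartial D i u) :=
  (u.2 i).choose_spec

/-- The gradient `∇ψ = (∂₁ψ, ∂₂ψ)`. -/
def grad (D : Opens Plane) : H1 D →ₗ[ℂ] VecL2 D :=
  LinearMap.pi ![weakPartial D 0, weakPartial D 1]

/-- The vector-valued curl of a scalar function, `∇ × ψ = (∂₂ψ, -∂₁ψ)`. -/
def vcurl (D : Opens Plane) : H1 D →ₗ[ℂ] VecL2 D :=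
  LinearMap.pi ![weakPartial D 1, -weakPartial D 0]

/-- The inner product `∫_D F̄ · G` of vector fields. -/
def vecInner (D : Opens Plane) (F G : VecL2 D) : ℂ :=
  inner ℂ (F 0) (G 0) + inner ℂ (F 1) (G 1)

/-- The pairs `(χ, ∇χ)` with `χ` a test function. -/
def testGraph (D : Opens Plane) : Submodule ℂ (L2 D × VecL2 D) where
  carrier := {p | ∃ χ : 𝓓(D, ℂ), p = (testToL2 D χ, fun i => testToL2 D (∂_{dir i} χ))}
  zero_mem' := ⟨0, by
    ext1
    · simp
    · funext i
      simp [LineDeriv.lineDerivOp_zero]⟩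
  add_mem' := by
    rintro _ _ ⟨χ, rfl⟩ ⟨η, rfl⟩
    refine ⟨χ + η, ?_⟩
    ext1
    · simp
    · funext i
      simp [LineDeriv.lineDerivOp_add]
  smul_mem' := by
    rintro a _ ⟨χ, rfl⟩
    refine ⟨a • χ, ?_⟩
    ext1
    · simp
    · funext i
      simp [LineDeriv.lineDerivOp_smul]

/-- `H¹₀(D)`, the closure of `C_c^∞(D)` in `H¹(D)`: convergence in `H¹(D)` is convergence of the
function and of its gradient in `L²`. -/
def H10 (D : Opens Plane) : Submodule ℂ (H1 D) :=
  (testGraph D).topologicalClosure.comap ((H1 D).subtype.prod (grad D))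

/-- `curl E = ∂₁E₂ - ∂₂E₁` equals `c` in the sense of distributions on `D`. -/
def HasCurl (D : Opens Plane) (E : VecL2 D) (c : L2 D) : Prop :=
  ∀ χ : 𝓓(D, ℂ), inner ℂ (testToL2 D (∂_{dir 1} χ)) (E 0)
    - inner ℂ (testToL2 D (∂_{dir 0} χ)) (E 1) = inner ℂ (testToL2 D χ) c

/-- `div E = ∂₁E₁ + ∂₂E₂` equals `d` in the sense of distributions on `D`. -/
def HasDiv (D : Opens Plane) (E : VecL2 D) (d : L2 D) : Prop :=
  ∀ χ : 𝓓(D, ℂ), inner ℂ (testToL2 D (∂_{dir 0} χ)) (E 0)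
    + inner ℂ (testToL2 D (∂_{dir 1} χ)) (E 1) = -inner ℂ (testToL2 D χ) d

/-- `E ∈ H₀(curl, D)` and `curl E = c`: the curl of `E` lies in `L²(D)`, and the tangential trace
of `E`, which Green's formula `⟨γ_t E, v⟩ = ∫_D (curl E) v̄ - ∫_D E · (∇ × v̄)`, `v ∈ H¹(D)`,
defines on `∂D`, is zero. -/
def HasCurlZeroTrace (D : Opens Plane) (E : VecL2 D) (c : L2 D) : Prop :=
  HasCurl D E c ∧ ∀ v : H1 D, inner ℂ (v : L2 D) c = vecInner D (vcurl D v) E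

/-- `H ∈ H₀(div, D)` and `div H = d`: the divergence of `H` lies in `L²(D)`, and the normal trace
of `H`, which Green's formula `⟨γ_n H, v⟩ = ∫_D (div H) v̄ + ∫_D H · ∇v̄`, `v ∈ H¹(D)`,
defines on `∂D`, is zero. -/
def HasDivZeroTrace (D : Opens Plane) (H : VecL2 D) (d : L2 D) : Prop :=
  HasDiv D H d ∧ ∀ v : H1 D, inner ℂ (v : L2 D) d = -vecInner D (grad D v) H

theorem vecInner_add (D : Opens Plane) (F G G' : VecL2 D) :
    vecInner D F (G + G') = vecInner D F G + vecInner D F G' := by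
  simp only [vecInner, Pi.add_apply, inner_add_right]
  ring

theorem vecInner_smul (D : Opens Plane) (F G : VecL2 D) (a : ℂ) :
    vecInner D F (a • G) = a * vecInner D F G := by
  simp only [vecInner, Pi.smul_apply, inner_smul_right]
  ring

theorem vecInner_zero (D : Opens Plane) (F : VecL2 D) : vecInner D F 0 = 0 := by
  simp [vecInner]

theorem HasCurl.zero (D : Opens Plane) : HasCurl D 0 0 := fun χ => by simp

theorem HasCurl.add {D : Opens Plane} {E E' : VecL2 D} {c c' : L2 D} (h : HasCurl D E c)
    (h' : HasCurl D E' c') : HasCurl D (E + E') (c + c') := fun χ => by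
  simp only [Pi.add_apply, inner_add_right]
  linear_combination h χ + h' χ

theorem HasCurl.smul {D : Opens Plane} {E : VecL2 D} {c : L2 D} (a : ℂ) (h : HasCurl D E c) :
    HasCurl D (a • E) (a • c) := fun χ => by
  simp only [Pi.smul_apply, inner_smul_right]
  linear_combination a * h χ

theorem HasDiv.zero (D : Opens Plane) : HasDiv D 0 0 := fun χ => by simp

theorem HasDiv.add {D : Opens Plane} {E E' : VecL2 D} {d d' : L2 D} (h : HasDiv D E d)
    (h' : HasDiv D E' d') : HasDiv D (E + E') (d + d') := fun χ => by
  simp only [Pi.add_apply, inner_add_right]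
  linear_combination h χ + h' χ

theorem HasDiv.smul {D : Opens Plane} {E : VecL2 D} {d : L2 D} (a : ℂ) (h : HasDiv D E d) :
    HasDiv D (a • E) (a • d) := fun χ => by
  simp only [Pi.smul_apply, inner_smul_right]
  linear_combination a * h χ

theorem HasCurlZeroTrace.zero (D : Opens Plane) : HasCurlZeroTrace D 0 0 :=
  ⟨HasCurl.zero D, fun v => by simp [vecInner_zero]⟩

theorem HasCurlZeroTrace.add {D : Opens Plane} {E E' : VecL2 D} {c c' : L2 D}
    (h : HasCurlZeroTrace D E c) (h' : HasCurlZeroTrace D E' c') :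
    HasCurlZeroTrace D (E + E') (c + c') :=
  ⟨h.1.add h'.1, fun v => by rw [inner_add_right, vecInner_add, h.2 v, h'.2 v]⟩

theorem HasCurlZeroTrace.smul {D : Opens Plane} {E : VecL2 D} {c : L2 D} (a : ℂ)
    (h : HasCurlZeroTrace D E c) : HasCurlZeroTrace D (a • E) (a • c) :=
  ⟨h.1.smul a, fun v => by rw [inner_smul_right, vecInner_smul, h.2 v]⟩

theorem HasDivZeroTrace.zero (D : Opens Plane) : HasDivZeroTrace D 0 0 :=
  ⟨HasDiv.zero D, fun v => by simp [vecInner_zero]⟩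

theorem HasDivZeroTrace.add {D : Opens Plane} {E E' : VecL2 D} {d d' : L2 D}
    (h : HasDivZeroTrace D E d) (h' : HasDivZeroTrace D E' d') :
    HasDivZeroTrace D (E + E') (d + d') :=
  ⟨h.1.add h'.1, fun v => by rw [inner_add_right, vecInner_add, h.2 v, h'.2 v]; ring⟩

theorem HasDivZeroTrace.smul {D : Opens Plane} {E : VecL2 D} {d : L2 D} (a : ℂ)
    (h : HasDivZeroTrace D E d) : HasDivZeroTrace D (a • E) (a • d) :=
  ⟨h.1.smul a, fun v => by rw [inner_smul_right, vecInner_smul, h.2 v]; ring⟩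

/-- The Dirichlet eigenspace of the Laplacian: `φ ∈ H¹₀(D)`, `-Δφ = lam φ` weakly. -/
def dirichletEigenspace (D : Opens Plane) (lam : ℝ) : Submodule ℂ (H1 D) where
  carrier := {φ | φ ∈ H10 D ∧ ∀ v ∈ H10 D,
    vecInner D (grad D v) (grad D φ) = (lam : ℂ) * inner ℂ (v : L2 D) (φ : L2 D)}
  zero_mem' := ⟨zero_mem _, fun v _ => by simp [vecInner_zero]⟩
  add_mem' {φ η} hφ hη := ⟨add_mem hφ.1 hη.1, fun v hv => by
    rw [map_add, vecInner_add, hφ.2 v hv, hη.2 v hv, Submodule.coe_add, inner_add_right]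
    ring⟩
  smul_mem' a φ hφ := ⟨Submodule.smul_mem _ a hφ.1, fun v hv => by
    rw [map_smul, vecInner_smul, hφ.2 v hv, Submodule.coe_smul, inner_smul_right]
    ring⟩

/-- The Neumann eigenspace of the Laplacian: `ψ ∈ H¹(D)`, `-Δψ = mu ψ` in `D` and `∂ψ/∂n = 0` on
`∂D` weakly. -/
def neumannEigenspace (D : Opens Plane) (mu : ℝ) : Submodule ℂ (H1 D) where
  carrier := {ψ | ∀ v : H1 D,
    vecInner D (grad D v) (grad D ψ) = (mu : ℂ) * inner ℂ (v : L2 D) (ψ : L2 D)}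
  zero_mem' := fun v => by simp [vecInner_zero]
  add_mem' {φ η} hφ hη := fun v => by
    rw [map_add, vecInner_add, hφ v, hη v, Submodule.coe_add, inner_add_right]
    ring
  smul_mem' a φ hφ := fun v => by
    rw [map_smul, vecInner_smul, hφ v, Submodule.coe_smul, inner_smul_right]
    ring

def IsDirichletEigenvalue (D : Opens Plane) (lam : ℝ) : Prop :=
  dirichletEigenspace D lam ≠ ⊥

def IsNeumannEigenvalue (D : Opens Plane) (mu : ℝ) : Prop :=
  neumannEigenspace D mu ≠ ⊥

/-- The eigenspace, for `β² = b`, of the transverse electric eigenproblem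
`E ∈ H₀(curl, D)`, `curl E ∈ H¹(D)`, `div E ∈ H¹₀(D)`,
`∇ × curl E - ω² E - ∇ div E = - β² E`. -/
def electricEigenspace (D : Opens Plane) (ω : ℝ) (b : ℂ) : Submodule ℂ (VecL2 D) where
  carrier := {E | ∃ c d : H1 D, HasCurlZeroTrace D E c ∧ HasDiv D E d ∧ d ∈ H10 D ∧
    vcurl D c - (ω : ℂ) ^ 2 • E - grad D d = -(b • E)}
  zero_mem' := ⟨0, 0, HasCurlZeroTrace.zero D, HasDiv.zero D, zero_mem _, by simp⟩
  add_mem' := by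
    rintro E E' ⟨c, d, h1, h2, h3, h4⟩ ⟨c', d', h1', h2', h3', h4'⟩
    refine ⟨c + c', d + d', h1.add h1', h2.add h2', add_mem h3 h3', ?_⟩
    rw [map_add, map_add, smul_add, smul_add, neg_add, ← h4, ← h4']
    abel
  smul_mem' := by
    rintro a E ⟨c, d, h1, h2, h3, h4⟩
    refine ⟨a • c, a • d, h1.smul a, h2.smul a, Submodule.smul_mem _ a h3, ?_⟩
    rw [map_smul, map_smul, smul_comm b a E, ← smul_neg, ← h4, smul_comm _ a E, smul_sub,
      smul_sub]

/-- The eigenspace, for `β² = b`, of the transverse magnetic eigenproblem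
`H ∈ H(curl, D) ∩ H₀(div, D)`, `curl H ∈ H¹₀(D)`, `div H ∈ H¹(D)`,
`∇ × curl H - ω² H - ∇ div H = - β² H`. -/
def magneticEigenspace (D : Opens Plane) (ω : ℝ) (b : ℂ) : Submodule ℂ (VecL2 D) where
  carrier := {H | ∃ c d : H1 D, HasCurl D H c ∧ c ∈ H10 D ∧ HasDivZeroTrace D H d ∧
    vcurl D c - (ω : ℂ) ^ 2 • H - grad D d = -(b • H)}
  zero_mem' := ⟨0, 0, HasCurl.zero D, zero_mem _, HasDivZeroTrace.zero D, by simp⟩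
  add_mem' := by
    rintro E E' ⟨c, d, h1, h2, h3, h4⟩ ⟨c', d', h1', h2', h3', h4'⟩
    refine ⟨c + c', d + d', h1.add h1', add_mem h2 h2', h3.add h3', ?_⟩
    rw [map_add, map_add, smul_add, smul_add, neg_add, ← h4, ← h4']
    abel
  smul_mem' := by
    rintro a E ⟨c, d, h1, h2, h3, h4⟩
    refine ⟨a • c, a • d, h1.smul a, Submodule.smul_mem _ a h2, h3.smul a, ?_⟩
    rw [map_smul, map_smul, smul_comm b a E, ← smul_neg, ← h4, smul_comm _ a E, smul_sub,
      smul_sub]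

/-- `b` is an eigenvalue `β²` of the transverse electric eigenproblem. -/
def IsElectricEigenvalue (D : Opens Plane) (ω : ℝ) (b : ℂ) : Prop :=
  electricEigenspace D ω b ≠ ⊥

/-- `b` is an eigenvalue `β²` of the transverse magnetic eigenproblem. -/
def IsMagneticEigenvalue (D : Opens Plane) (ω : ℝ) (b : ℂ) : Prop :=
  magneticEigenspace D ω b ≠ ⊥

end Waveguide

end

open Waveguide

/-!
Write `β² = ω² - k`, `c = curl E` and `d = div E`. The electric equation then reads
`k E = ∇ × c - ∇ d`. Two orthogonality relations drive everything: `∇ × v` (`v ∈ H¹`) is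
orthogonal to `∇ φ` (`φ ∈ H¹₀`), because mixed derivatives of test functions commute
(`vecInner_vcurl_grad`), and `∇ ×` is `∇` followed by a rotation. Inserting the equation in
Green's formulas for `curl E` and `div E` shows that `c` is a weak Neumann and `d` a weak Dirichlet
eigenfunction with eigenvalue `k` (`neumann_of_electric`, `dirichlet_of_electric`). If `k ≠ 0`, one
of them is nonzero, so `k` is a Rayleigh quotient, hence real and positive, and
`E = (∇ × c - ∇ d) / k` lies in the orthogonal sum of `∇ × V^Neu` and `∇ V^Dir`
(`electricEigenspace_eq_sup`); injectivity of the two operators gives the multiplicities.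

The value `k = 0` has to be excluded, and this is where the topology of `D` is used. There `c` and
`d` vanish, so that `E` has no curl, no divergence and no tangential trace
(`eq_zero_of_hasCurl_of_hasDiv`). The function `Re E₁ - i Re E₂` satisfies the Cauchy–Riemann
equations weakly, and by Weyl's lemma (`IsWeaklyHolomorphic.exists_differentiableOn`) it is
holomorphic; on the simply connected `D` it has a primitive, whose imaginary part `w` satisfies
`∇ × w = Re E`. No regularity of the boundary is available, so `w` need not be square integrable,
but `arctan w` belongs to `H¹(D)` and may be used in Green's formula, which yields
`∫ |Re E|² / (1 + w²) = 0`. The same applies to `-i E`, that is, to the imaginary part.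

Weyl's lemma rests on mollifying with `∂/∂z̄` of a smoothed Cauchy kernel: the difference of two such
mollifiers is `∂/∂z̄` of a test function, so the mollifications do not depend on the scale. The
primitive is glued from local ones by lifting the identity to a covering space with discrete fibre.

The magnetic problem is the electric problem rotated by a right angle
(`rotation_mem_magneticEigenspace`).
-/

noncomputable section

namespace Waveguide

/-! ### Gradients, rotated gradients and integration by parts -/

variable {D : Opens Plane}

@[simp] theorem grad_zero (u : H1 D) : grad D u 0 = weakPartial D 0 u := rfl
@[simp] theorem grad_one (u : H1 D) : grad D u 1 = weakPartial D 1 u := rfl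
@[simp] theorem vcurl_zero (u : H1 D) : vcurl D u 0 = weakPartial D 1 u := rfl
@[simp] theorem vcurl_one (u : H1 D) : vcurl D u 1 = -weakPartial D 0 u := rfl

theorem vecInner_sub (F G G' : VecL2 D) :
    vecInner D F (G - G') = vecInner D F G - vecInner D F G' := by
  simp only [vecInner, Pi.sub_apply, inner_sub_right]
  ring

theorem vecInner_conj_symm (F G : VecL2 D) :
    (starRingEnd ℂ) (vecInner D F G) = vecInner D G F := by
  simp only [vecInner, map_add, inner_conj_symm]

theorem vecInner_eq_zero_comm {F G : VecL2 D} :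
    vecInner D F G = 0 ↔ vecInner D G F = 0 := by
  rw [← vecInner_conj_symm F G, map_eq_zero]

/-- The squared `L²` norm of a vector field. -/
theorem vecInner_self (F : VecL2 D) :
    vecInner D F F = ((‖F 0‖ ^ 2 + ‖F 1‖ ^ 2 : ℝ) : ℂ) := by
  simp [vecInner, inner_self_eq_norm_sq_to_K]

theorem vecInner_self_eq_zero {F : VecL2 D} : vecInner D F F = 0 ↔ F = 0 := by
  constructor
  · intro h
    rw [vecInner_self, Complex.ofReal_eq_zero] at h
    have h0 : ‖F 0‖ = 0 := by nlinarith [sq_nonneg ‖F 0‖, sq_nonneg ‖F 1‖]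
    have h1 : ‖F 1‖ = 0 := by nlinarith [sq_nonneg ‖F 0‖, sq_nonneg ‖F 1‖]
    funext i
    fin_cases i
    · simpa using h0
    · simpa using h1
  · rintro rfl
    exact vecInner_zero D 0

/-- The rotation by a right angle that turns `vcurl` into `grad` is an isometry. -/
theorem vecInner_vcurl_vcurl (u v : H1 D) :
    vecInner D (vcurl D u) (vcurl D v) = vecInner D (grad D u) (grad D v) := by
  simp only [vecInner, vcurl_zero, vcurl_one, inner_neg_neg, grad_zero, grad_one]
  exact add_comm _ _

theorem vcurl_eq_zero_iff {u : H1 D} : vcurl D u = 0 ↔ grad D u = 0 := by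
  rw [← vecInner_self_eq_zero, vecInner_vcurl_vcurl, vecInner_self_eq_zero]

theorem lineDerivOp_apply (χ : 𝓓(D, ℂ)) (v x : Plane) :
    (∂_{v} χ) x = fderiv ℝ χ x v := by
  rw [TestFunction.lineDerivOp_eq_lineDerivCLM ℝ, TestFunction.lineDerivCLM_eq_fderivCLM,
    TestFunction.fderivCLM_apply]
  simp

theorem lineDerivOp_comm (χ : 𝓓(D, ℂ)) (v w : Plane) : ∂_{v} (∂_{w} χ) = ∂_{w} (∂_{v} χ) := by
  have hd : Differentiable ℝ (fderiv ℝ χ) :=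
    (χ.contDiff.fderiv_right (m := 1) (by norm_cast)).differentiable (by norm_num)
  have key (a b x : Plane) : (∂_{a} (∂_{b} χ)) x = fderiv ℝ (fderiv ℝ χ) x a b := by
    have h : ((∂_{b} χ : 𝓓(D, ℂ)) : Plane → ℂ) = fun y => fderiv ℝ χ y b :=
      funext (lineDerivOp_apply χ b)
    rw [lineDerivOp_apply, h,
      fderiv_clm_apply (hd x) (differentiableAt_const b)]
    simp
  ext x
  rw [key, key]
  exact (χ.contDiff.contDiffAt.isSymmSndFDerivAt (by simpa using by norm_cast)).eq v w

/-- `div (∇ × u) = 0`: mixed partial derivatives of test functions commute. -/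
theorem hasDiv_vcurl (u : H1 D) : HasDiv D (vcurl D u) 0 := fun χ => by
  have h0 := weakPartial_spec D 0 u (∂_{dir 1} χ)
  have h1 := weakPartial_spec D 1 u (∂_{dir 0} χ)
  rw [lineDerivOp_comm] at h1
  simp only [vcurl_zero, vcurl_one, inner_neg_right, inner_zero_right]
  linear_combination h1 - h0

/-- `curl (∇ u) = 0`: mixed partial derivatives of test functions commute. -/
theorem hasCurl_grad (u : H1 D) : HasCurl D (grad D u) 0 := fun χ => by
  have h0 := weakPartial_spec D 0 u (∂_{dir 1} χ)
  have h1 := weakPartial_spec D 1 u (∂_{dir 0} χ)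
  rw [lineDerivOp_comm] at h1
  simp only [grad_zero, grad_one, inner_zero_right]
  linear_combination h0 - h1

/-- Test functions are dense in `H¹₀(D)`, so an identity that is continuous in the graph norm and
holds for test functions holds on `H¹₀(D)`. -/
theorem vecInner_grad_eq_inner_of_mem_H10 {F : VecL2 D} {g : L2 D}
    (h : ∀ χ : 𝓓(D, ℂ), vecInner D (fun i => testToL2 D (∂_{dir i} χ)) F =
      inner ℂ (testToL2 D χ) g) {v : H1 D} (hv : v ∈ H10 D) :
    vecInner D (grad D v) F = inner ℂ (v : L2 D) g := by
  have hcl : IsClosed {p : L2 D × VecL2 D | vecInner D p.2 F = inner ℂ p.1 g} := by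
    refine isClosed_eq ?_ (by fun_prop)
    unfold vecInner
    fun_prop
  have hsub : ((testGraph D : Submodule ℂ (L2 D × VecL2 D)) : Set (L2 D × VecL2 D)) ⊆
      {p : L2 D × VecL2 D | vecInner D p.2 F = inner ℂ p.1 g} := by
    rintro _ ⟨χ, rfl⟩
    exact h χ
  exact closure_minimal hsub hcl hv

/-- Green's formula for the divergence against `H¹₀(D)`. -/
theorem HasDiv.vecInner_grad {F : VecL2 D} {d : L2 D} (h : HasDiv D F d) {v : H1 D}
    (hv : v ∈ H10 D) : vecInner D (grad D v) F = -inner ℂ (v : L2 D) d := by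
  rw [← inner_neg_right]
  exact vecInner_grad_eq_inner_of_mem_H10 (fun χ => by rw [inner_neg_right]; exact h χ) hv

/-- Rotated gradients of `H¹(D)` are orthogonal to gradients of `H¹₀(D)`. -/
theorem vecInner_grad_vcurl {v : H1 D} (hv : v ∈ H10 D) (u : H1 D) :
    vecInner D (grad D v) (vcurl D u) = 0 := by
  simpa using (hasDiv_vcurl u).vecInner_grad hv

theorem vecInner_vcurl_grad {v : H1 D} (hv : v ∈ H10 D) (u : H1 D) :
    vecInner D (vcurl D u) (grad D v) = 0 :=
  vecInner_eq_zero_comm.1 (vecInner_grad_vcurl hv u)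

/-! ### The Poincaré inequality on `H¹₀(D)` -/

theorem norm_fderiv_le_partials (f : Plane → ℂ) (x : Plane) :
    ‖fderiv ℝ f x‖ ≤ ‖fderiv ℝ f x (dir 0)‖ + ‖fderiv ℝ f x (dir 1)‖ := by
  refine ContinuousLinearMap.opNorm_le_bound _ (by positivity) fun y => ?_
  have hy : y = y 0 • dir 0 + y 1 • dir 1 := by
    ext i
    fin_cases i <;> simp [dir]
  have h0 : ‖y 0‖ ≤ ‖y‖ := PiLp.norm_apply_le y 0
  have h1 : ‖y 1‖ ≤ ‖y‖ := PiLp.norm_apply_le y 1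
  calc ‖fderiv ℝ f x y‖ = ‖y 0 • fderiv ℝ f x (dir 0) + y 1 • fderiv ℝ f x (dir 1)‖ := by
        conv_lhs => rw [hy, map_add, map_smul, map_smul]
    _ ≤ ‖y 0‖ * ‖fderiv ℝ f x (dir 0)‖ + ‖y 1‖ * ‖fderiv ℝ f x (dir 1)‖ := by
        refine (norm_add_le _ _).trans ?_
        rw [norm_smul, norm_smul]
    _ ≤ ‖y‖ * ‖fderiv ℝ f x (dir 0)‖ + ‖y‖ * ‖fderiv ℝ f x (dir 1)‖ := by gcongr
    _ = _ := by ring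

/-- The Poincaré inequality for test functions, from the Gagliardo–Nirenberg–Sobolev inequality
`‖χ‖₂ ≤ C ‖∇χ‖₁` of the plane and the finite area of `D`. -/
theorem exists_norm_testToL2_le (hbdd : Bornology.IsBounded (D : Set Plane)) :
    ∃ C : ℝ, ∀ χ : 𝓓(D, ℂ), ‖testToL2 D χ‖ ≤
      C * (‖testToL2 D (∂_{dir 0} χ)‖ + ‖testToL2 D (∂_{dir 1} χ)‖) := by
  set μ := (volume : Measure Plane).restrict (D : Set Plane) with hμ
  have hfin : IsFiniteMeasure μ := ⟨by simpa [hμ] using hbdd.measure_lt_top⟩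
  set A : ENNReal := eLpNormLESNormFDerivOneConst (volume : Measure Plane) ((2 : NNReal) : ℝ) *
    μ Set.univ ^ (1 / (2 : ℝ)) with hA
  have hAtop : A ≠ ⊤ := by
    refine ENNReal.mul_ne_top ENNReal.coe_ne_top ?_
    exact ENNReal.rpow_ne_top_of_nonneg (by norm_num) (measure_ne_top μ _)
  refine ⟨A.toReal, fun χ => ?_⟩
  have hconj : NNReal.HolderConjugate (Module.finrank ℝ Plane) 2 := by
    rw [finrank_euclideanSpace_fin]
    exact NNReal.HolderConjugate.two_two
  have h1 := eLpNorm_le_eLpNorm_fderiv_one (volume : Measure Plane)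
    (χ.contDiff.of_le (by norm_cast)) χ.hasCompactSupport hconj
  have hs : Function.support (χ : Plane → ℂ) ⊆ D := (subset_tsupport _).trans χ.tsupport_subset
  have hs' : Function.support (fderiv ℝ (χ : Plane → ℂ)) ⊆ D :=
    (support_fderiv_subset ℝ).trans χ.tsupport_subset
  rw [← eLpNorm_restrict_eq_of_support_subset hs, ← eLpNorm_restrict_eq_of_support_subset (f := fderiv ℝ (χ : Plane → ℂ)) hs',
    ← hμ, ENNReal.coe_ofNat] at h1
  have hcont : Continuous (fderiv ℝ (χ : Plane → ℂ)) :=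
    χ.contDiff.continuous_fderiv (by norm_num)
  have h2 : eLpNorm (fderiv ℝ (χ : Plane → ℂ)) 1 μ ≤
      eLpNorm (fderiv ℝ (χ : Plane → ℂ)) 2 μ * μ Set.univ ^ (1 / (2 : ℝ)) := by
    refine (eLpNorm_le_eLpNorm_mul_rpow_measure_univ (p := 1) (q := 2) (by norm_num)
      hcont.aestronglyMeasurable).trans_eq ?_
    norm_num
  have hm (i : Fin 2) : MemLp (fun x => fderiv ℝ χ x (dir i)) 2 μ := by
    have := testFunction_memLp D (∂_{dir i} χ)
    rwa [show ((∂_{dir i} χ : 𝓓(D, ℂ)) : Plane → ℂ) = fun x => fderiv ℝ χ x (dir i) from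
      funext (lineDerivOp_apply χ _)] at this
  have hnorm (i : Fin 2) : ‖testToL2 D (∂_{dir i} χ)‖ =
      (eLpNorm (fun x => fderiv ℝ χ x (dir i)) 2 μ).toReal := by
    change ‖(testFunction_memLp D (∂_{dir i} χ)).toLp _‖ = _
    rw [Lp.norm_toLp, show ((∂_{dir i} χ : 𝓓(D, ℂ)) : Plane → ℂ) = fun x => fderiv ℝ χ x (dir i)
      from funext (lineDerivOp_apply χ _)]
  have h3 : eLpNorm (fderiv ℝ (χ : Plane → ℂ)) 2 μ ≤
      eLpNorm (fun x => fderiv ℝ χ x (dir 0)) 2 μ +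
        eLpNorm (fun x => fderiv ℝ χ x (dir 1)) 2 μ := by
    calc eLpNorm (fderiv ℝ (χ : Plane → ℂ)) 2 μ
        ≤ eLpNorm ((fun x => ‖fderiv ℝ χ x (dir 0)‖) + fun x => ‖fderiv ℝ χ x (dir 1)‖) 2 μ :=
          eLpNorm_mono_real (norm_fderiv_le_partials χ)
      _ ≤ _ := by
          refine (eLpNorm_add_le (hm 0).1.norm (hm 1).1.norm (by norm_num)).trans_eq ?_
          rw [eLpNorm_norm, eLpNorm_norm]
  have h4 : eLpNorm (χ : Plane → ℂ) 2 μ ≤ A * (eLpNorm (fun x => fderiv ℝ χ x (dir 0)) 2 μ +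
        eLpNorm (fun x => fderiv ℝ χ x (dir 1)) 2 μ) := by
    refine h1.trans ?_
    rw [hA, mul_assoc, mul_comm (μ Set.univ ^ _)]
    gcongr
    exact h2.trans (by gcongr)
  have hlhs : ‖testToL2 D χ‖ = (eLpNorm (χ : Plane → ℂ) 2 μ).toReal :=
    Lp.norm_toLp _ (testFunction_memLp D χ)
  rw [hlhs, hnorm, hnorm, ← ENNReal.toReal_add (hm 0).2.ne (hm 1).2.ne, ← ENNReal.toReal_mul]
  exact ENNReal.toReal_mono
    (ENNReal.mul_ne_top hAtop (ENNReal.add_ne_top.2 ⟨(hm 0).2.ne, (hm 1).2.ne⟩)) h4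

theorem eq_zero_of_mem_H10_of_grad_eq_zero (hbdd : Bornology.IsBounded (D : Set Plane))
    {φ : H1 D} (hφ : φ ∈ H10 D) (h : grad D φ = 0) : φ = 0 := by
  obtain ⟨C, hC⟩ := exists_norm_testToL2_le hbdd
  have hcl : IsClosed {p : L2 D × VecL2 D | ‖p.1‖ ≤ C * (‖p.2 0‖ + ‖p.2 1‖)} :=
    isClosed_le (by fun_prop) (by fun_prop)
  have hsub : ((testGraph D : Submodule ℂ (L2 D × VecL2 D)) : Set (L2 D × VecL2 D)) ⊆
      {p : L2 D × VecL2 D | ‖p.1‖ ≤ C * (‖p.2 0‖ + ‖p.2 1‖)} := by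
    rintro _ ⟨χ, rfl⟩
    exact hC χ
  have hp : ‖(φ : L2 D)‖ ≤ C * (‖grad D φ 0‖ + ‖grad D φ 1‖) := by
    have hmem : ((φ : L2 D), grad D φ) ∈ closure (testGraph D : Set (L2 D × VecL2 D)) := hφ
    have := closure_minimal hsub hcl hmem
    rwa [Set.mem_ofPred_eq] at this
  rw [h] at hp
  have : ‖(φ : L2 D)‖ ≤ 0 := by simpa using hp
  exact Subtype.ext (norm_le_zero_iff.1 this)

/-! ### Weyl's lemma for the Cauchy–Riemann operator -/

section

open Filter Topology Metric

/-- Twice the Cauchy–Riemann operator, `2 ∂f/∂z̄ = ∂f/∂x + i ∂f/∂y`. -/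
def dbar (f : ℂ → ℂ) (z : ℂ) : ℂ := fderiv ℝ f z 1 + Complex.I * fderiv ℝ f z Complex.I

/-- A smooth monotone step from `0` (on `s ≤ 1 / 2`) to `1` (on `s ≥ 1`). -/
def step (s : ℝ) : ℝ := Real.smoothTransition (2 * s - 1)

theorem step_contDiff {n : ℕ∞} : ContDiff ℝ n step :=
  Real.smoothTransition.contDiff.comp ((contDiff_const.mul contDiff_id).sub contDiff_const)

theorem step_monotone : Monotone step := fun _ _ h =>
  Real.smoothTransition.monotone (by linarith)

theorem step_of_le_half {s : ℝ} (h : s ≤ 1 / 2) : step s = 0 :=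
  Real.smoothTransition.zero_of_nonpos (by linarith)

theorem step_of_one_le {s : ℝ} (h : 1 ≤ s) : step s = 1 :=
  Real.smoothTransition.one_of_one_le (by linarith)

theorem deriv_step_nonneg (s : ℝ) : 0 ≤ deriv step s := step_monotone.deriv_nonneg

theorem deriv_step_of_one_lt {s : ℝ} (h : 1 < s) : deriv step s = 0 := by
  have : step =ᶠ[𝓝 s] fun _ => 1 := by
    filter_upwards [lt_mem_nhds h] with t ht using step_of_one_le ht.le
  rw [this.deriv_eq, deriv_const]

theorem exists_deriv_step_ne_zero : ∃ s, 0 < s ∧ deriv step s ≠ 0 := by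
  obtain ⟨s, hs, h⟩ := exists_deriv_eq_slope step (a := 1 / 2) (b := 1) (by norm_num)
    (step_contDiff (n := 1)).continuous.continuousOn ((step_contDiff (n := 1)).differentiable
      (by norm_num)).differentiableOn
  refine ⟨s, by linarith [hs.1], ?_⟩
  rw [h, step_of_le_half le_rfl, step_of_one_le le_rfl]
  norm_num

/-- The fundamental solution `1 / z` of the Cauchy–Riemann operator, smoothed out inside the disc
of radius `ε`. -/
def smoothCauchy (ε : ℝ) (z : ℂ) : ℂ := (step (Complex.normSq z / ε ^ 2) : ℂ) * z⁻¹

/-- The approximate identity `∂/∂z̄` of the smoothed Cauchy kernel: a nonnegative radial bump of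
width `ε` whose mass does not depend on `ε`. -/
def mollifier (ε : ℝ) (z : ℂ) : ℝ := deriv step (Complex.normSq z / ε ^ 2) / ε ^ 2

theorem contDiff_normSq {n : ℕ∞} : ContDiff ℝ n (fun z : ℂ => Complex.normSq z) := by
  have : (fun z : ℂ => Complex.normSq z) = fun z : ℂ => ‖z‖ ^ 2 := by
    funext z
    exact Complex.normSq_eq_norm_sq z
  rw [this]
  exact contDiff_norm_sq ℝ

theorem mollifier_contDiff {n : ℕ∞} (ε : ℝ) : ContDiff ℝ n (mollifier ε) := by
  have h : ContDiff ℝ n (deriv step) :=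
    (contDiff_succ_iff_deriv.1 (step_contDiff (n := n + 1))).2.2
  exact (h.comp (contDiff_normSq.div_const _)).div_const _

theorem mollifier_nonneg (ε : ℝ) (z : ℂ) : 0 ≤ mollifier ε z :=
  div_nonneg (deriv_step_nonneg _) (sq_nonneg _)

theorem mollifier_of_lt {ε : ℝ} (hε : 0 < ε) {z : ℂ} (hz : ε < ‖z‖) : mollifier ε z = 0 := by
  unfold mollifier
  rw [deriv_step_of_one_lt, zero_div]
  rw [one_lt_div (by positivity), Complex.normSq_eq_norm_sq]
  gcongr

theorem support_mollifier_subset {ε : ℝ} (hε : 0 < ε) :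
    Function.support (mollifier ε) ⊆ closedBall 0 ε := fun z hz => by
  by_contra h
  exact hz (mollifier_of_lt hε (by simpa using h))

theorem mollifier_hasCompactSupport {ε : ℝ} (hε : 0 < ε) : HasCompactSupport (mollifier ε) :=
  HasCompactSupport.of_support_subset_isCompact (isCompact_closedBall 0 ε)
    (support_mollifier_subset hε)

theorem smoothCauchy_eq_inv {ε : ℝ} (hε : 0 < ε) {z : ℂ} (hz : ε ≤ ‖z‖) :
    smoothCauchy ε z = z⁻¹ := by
  unfold smoothCauchy
  rw [step_of_one_le, Complex.ofReal_one, one_mul]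
  rw [one_le_div (by positivity), Complex.normSq_eq_norm_sq]
  gcongr

theorem smoothCauchy_eventuallyEq_zero (ε : ℝ) :
    smoothCauchy ε =ᶠ[𝓝 0] fun _ => 0 := by
  have hc : ContinuousAt (fun z : ℂ => Complex.normSq z / ε ^ 2) 0 :=
    (Complex.continuous_normSq.div_const _).continuousAt
  have : ∀ᶠ z in 𝓝 (0 : ℂ), Complex.normSq z / ε ^ 2 < 1 / 2 :=
    hc.eventually_lt_const (by simp)
  filter_upwards [this] with z hz
  simp [smoothCauchy, step_of_le_half hz.le]

theorem smoothCauchy_contDiff {n : ℕ∞} (ε : ℝ) : ContDiff ℝ n (smoothCauchy ε) := by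
  rw [contDiff_iff_contDiffAt]
  intro z
  by_cases hz : z = 0
  · rw [hz]
    exact contDiffAt_const.congr_of_eventuallyEq (smoothCauchy_eventuallyEq_zero ε)
  · have h1 : ContDiff ℝ n (fun z : ℂ => (step (Complex.normSq z / ε ^ 2) : ℂ)) :=
      Complex.ofRealCLM.contDiff.comp (step_contDiff.comp (contDiff_normSq.div_const _))
    exact h1.contDiffAt.mul ((contDiffAt_inv ℂ hz).restrict_scalars ℝ)

theorem dbar_smoothCauchy (ε : ℝ) (z : ℂ) :
    dbar (smoothCauchy ε) z = 2 * (mollifier ε z : ℂ) := by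
  by_cases hz : z = 0
  · have h0 : deriv step (Complex.normSq z / ε ^ 2) = 0 := by
      have : step =ᶠ[𝓝 (Complex.normSq z / ε ^ 2)] fun _ => 0 := by
        have : Complex.normSq z / ε ^ 2 < 1 / 2 := by simp [hz]
        filter_upwards [gt_mem_nhds this] with t ht using step_of_le_half ht.le
      rw [this.deriv_eq, deriv_const]
    have h1 : fderiv ℝ (smoothCauchy ε) z = 0 := by
      rw [hz, (smoothCauchy_eventuallyEq_zero ε).fderiv_eq]
      simp
    simp [dbar, mollifier, h0, h1]
  · have hn : HasFDerivAt (fun z : ℂ => Complex.normSq z)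
        ((2 * z.re) • Complex.reCLM + (2 * z.im) • Complex.imCLM) z := by
      have := ((Complex.reCLM.hasFDerivAt (x := z)).mul (Complex.reCLM.hasFDerivAt (x := z))).add
        ((Complex.imCLM.hasFDerivAt (x := z)).mul (Complex.imCLM.hasFDerivAt (x := z)))
      refine (this.congr_of_eventuallyEq
        (.of_forall fun w => Complex.normSq_apply w)).congr_fderiv ?_
      ext
      simp
      ring
    have hs : HasDerivAt step (deriv step (Complex.normSq z / ε ^ 2))
        (Complex.normSq z / ε ^ 2) :=
      ((step_contDiff (n := 1)).differentiable (by norm_num) _).hasDerivAt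
    have h1 := Complex.ofRealCLM.hasFDerivAt.comp z
      (hs.comp_hasFDerivAt z (hn.mul_const ((ε ^ 2)⁻¹)))
    have h2 : HasFDerivAt (fun z : ℂ => z⁻¹) _ z := (hasDerivAt_inv hz).hasFDerivAt.restrictScalars ℝ
    have h3 : HasFDerivAt (smoothCauchy ε) _ z := h1.mul h2
    have hz2 : z = z.re + z.im * Complex.I := (Complex.re_add_im z).symm
    rw [dbar, h3.fderiv]
    simp [mollifier]
    field_simp
    linear_combination (-(step (Complex.normSq z / ε ^ 2) : ℂ)) * Complex.I_sq -
      2 * ((deriv step (Complex.normSq z / ε ^ 2) : ℝ) : ℂ) * (ε : ℂ)⁻¹ ^ 2 * z * hz2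

theorem integral_mollifier {ε : ℝ} (hε : 0 < ε) :
    ∫ z, mollifier ε z = ∫ z, mollifier 1 z := by
  have h := Measure.integral_comp_inv_smul (volume : Measure ℂ) (mollifier 1) ε
  rw [Complex.finrank_real_complex, abs_of_pos (by positivity), smul_eq_mul] at h
  have h2 : ∀ z, mollifier ε z = (ε ^ 2)⁻¹ * mollifier 1 (ε⁻¹ • z) := fun z => by
    simp only [mollifier, Complex.normSq_eq_norm_sq, norm_smul, norm_inv, Real.norm_eq_abs,
      abs_of_pos hε]
    field_simp
  simp_rw [h2]
  rw [integral_const_mul, h]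
  field_simp

theorem integral_mollifier_one_pos : 0 < ∫ z, mollifier 1 z := by
  refine (mollifier_contDiff (n := 0) 1).continuous.integral_pos_of_hasCompactSupport_nonneg_nonzero
    (mollifier_hasCompactSupport one_pos) (mollifier_nonneg 1) (x := ?_) ?_
  · exact ((Real.sqrt exists_deriv_step_ne_zero.choose : ℝ) : ℂ)
  · obtain ⟨h0, h1⟩ := exists_deriv_step_ne_zero.choose_spec
    simpa [mollifier, Real.mul_self_sqrt h0.le] using h1

theorem exists_mollifier_le : ∃ M : ℝ, 0 ≤ M ∧ ∀ ε z, mollifier ε z ≤ M / ε ^ 2 := by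
  obtain ⟨M, hM⟩ := (mollifier_contDiff (n := 0) 1).continuous.bounded_above_of_compact_support
    (mollifier_hasCompactSupport one_pos)
  refine ⟨M, (norm_nonneg _).trans (hM 0), fun ε z => ?_⟩
  unfold mollifier
  gcongr
  have hs : 0 ≤ Complex.normSq z / ε ^ 2 := div_nonneg (Complex.normSq_nonneg z) (sq_nonneg ε)
  have := (le_abs_self _).trans (hM ((Real.sqrt (Complex.normSq z / ε ^ 2) : ℝ) : ℂ))
  simpa [mollifier, Real.mul_self_sqrt hs] using this

/-- `f` is a weak solution in `U` of the Cauchy–Riemann equation `∂f/∂z̄ = 0`. -/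
def IsWeaklyHolomorphic (f : ℂ → ℂ) (U : Set ℂ) : Prop :=
  ∀ χ : ℂ → ℂ, ContDiff ℝ (⊤ : ℕ∞) χ → HasCompactSupport χ → tsupport χ ⊆ U →
    ∫ w, f w * dbar χ w = 0

theorem dbar_comp_const_sub {h : ℂ → ℂ} (hd : Differentiable ℝ h) (x w : ℂ) :
    dbar (fun w => h (x - w)) w = -dbar h (x - w) := by
  have : fderiv ℝ (fun w => h (x - w)) w = -fderiv ℝ h (x - w) := by
    have hsub : HasFDerivAt (fun w : ℂ => x - w) (-ContinuousLinearMap.id ℝ ℂ) w :=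
      (hasFDerivAt_id w).const_sub x
    refine ((hd (x - w)).hasFDerivAt.comp w hsub).fderiv.trans ?_
    ext
    simp
  simp only [dbar, this, neg_apply]
  ring

/-- The mollification of `f` at scale `ε`. -/
def mollify (f : ℂ → ℂ) (ε : ℝ) (x : ℂ) : ℂ := ∫ w, f w * (mollifier ε (x - w) : ℂ)

theorem integrable_mul_mollifier {f : ℂ → ℂ} (hf : LocallyIntegrable f) {ε : ℝ} (hε : 0 < ε)
    (x : ℂ) : Integrable fun w => f w * (mollifier ε (x - w) : ℂ) := by
  have hc : Continuous fun w => (mollifier ε (x - w) : ℂ) :=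
    Complex.continuous_ofReal.comp
      ((mollifier_contDiff (n := 0) ε).continuous.comp (continuous_const.sub continuous_id))
  have hs : HasCompactSupport fun w => (mollifier ε (x - w) : ℂ) := by
    refine HasCompactSupport.of_support_subset_isCompact (isCompact_closedBall x ε) fun w hw => ?_
    have : mollifier ε (x - w) ≠ 0 := by simpa using hw
    have := support_mollifier_subset hε this
    simpa [dist_eq_norm, norm_sub_rev] using this
  have := hf.integrable_smul_left_of_hasCompactSupport hc hs
  simpa [mul_comm] using this

/-- Mollifications of a weakly holomorphic function at two scales agree: the difference of the
mollifiers is `∂/∂z̄` of the difference of two smoothed Cauchy kernels, a test function. -/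
theorem IsWeaklyHolomorphic.mollify_eq {f : ℂ → ℂ} {U : Set ℂ} (hw : IsWeaklyHolomorphic f U)
    (hf : LocallyIntegrable f) {ε δ : ℝ} (hε : 0 < ε) (hδ : 0 < δ) {x : ℂ}
    (hxε : closedBall x ε ⊆ U) (hxδ : closedBall x δ ⊆ U) : mollify f ε x = mollify f δ x := by
  set h : ℂ → ℂ := fun z => smoothCauchy ε z - smoothCauchy δ z with hh
  have hsm : ContDiff ℝ (⊤ : ℕ∞) h := (smoothCauchy_contDiff ε).sub (smoothCauchy_contDiff δ)
  have hsupp : tsupport (fun w => h (x - w)) ⊆ closedBall x (max ε δ) := by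
    refine closure_minimal (fun w hw => ?_) isClosed_closedBall
    by_contra hlt
    rw [mem_closedBall, not_le, max_lt_iff, dist_eq_norm, norm_sub_rev] at hlt
    exact hw (by simp [hh, smoothCauchy_eq_inv hε hlt.1.le, smoothCauchy_eq_inv hδ hlt.2.le])
  have hU : closedBall x (max ε δ) ⊆ U := by
    rcases le_total ε δ with hle | hle
    · rwa [max_eq_right hle]
    · rwa [max_eq_left hle]
  have key := hw (fun w => h (x - w)) (hsm.comp (contDiff_const.sub contDiff_id))
    ((isCompact_closedBall x _).of_isClosed_subset (isClosed_tsupport _) hsupp) (hsupp.trans hU)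
  have hd : ∀ z, dbar h z = 2 * (mollifier ε z : ℂ) - 2 * (mollifier δ z : ℂ) := fun z => by
    rw [← dbar_smoothCauchy, ← dbar_smoothCauchy]
    have h1 := ((smoothCauchy_contDiff (n := 1) ε).differentiable (by norm_num)) z
    have h2 := ((smoothCauchy_contDiff (n := 1) δ).differentiable (by norm_num)) z
    simp only [dbar, hh]
    rw [fderiv_fun_sub h1 h2]
    simp only [sub_apply]
    ring
  have heq : ∀ w, f w * dbar (fun w => h (x - w)) w =
      (-2) * (f w * (mollifier ε (x - w) : ℂ) - f w * (mollifier δ (x - w) : ℂ)) := fun w => by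
    rw [dbar_comp_const_sub (hsm.differentiable (by norm_num)), hd]
    ring
  simp_rw [heq] at key
  rw [integral_const_mul, integral_sub (integrable_mul_mollifier hf hε x)
    (integrable_mul_mollifier hf hδ x)] at key
  exact sub_eq_zero.1 ((mul_eq_zero.1 key).resolve_left (by norm_num))

open scoped Convolution in
theorem mollify_eq_convolution (f : ℂ → ℂ) (ε : ℝ) :
    mollify f ε = f ⋆[ContinuousLinearMap.mul ℝ ℂ, volume] fun z => (mollifier ε z : ℂ) := rfl

/-- The mollification of a weakly holomorphic function is holomorphic where it is defined. -/
theorem IsWeaklyHolomorphic.differentiableAt_mollify {f : ℂ → ℂ} {U : Set ℂ}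
    (hw : IsWeaklyHolomorphic f U) (hf : LocallyIntegrable f) {ε : ℝ} (hε : 0 < ε) {x : ℂ}
    (hx : closedBall x ε ⊆ U) : DifferentiableAt ℂ (mollify f ε) x := by
  have hsm : ContDiff ℝ (⊤ : ℕ∞) fun z => (mollifier ε z : ℂ) :=
    Complex.ofRealCLM.contDiff.comp (mollifier_contDiff ε)
  have hcs : HasCompactSupport fun z => (mollifier ε z : ℂ) :=
    (mollifier_hasCompactSupport hε).comp_left (g := ((↑) : ℝ → ℂ)) Complex.ofReal_zero
  have hder := hcs.hasFDerivAt_convolution_right (ContinuousLinearMap.mul ℝ ℂ) hf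
    (hsm.of_le (by norm_cast)) x
  rw [← mollify_eq_convolution] at hder
  have hconv := (hcs.fderiv ℝ).convolutionExists_right
    ((ContinuousLinearMap.mul ℝ ℂ).precompR ℂ) hf (hsm.continuous_fderiv (by norm_num)) x
  have happ (v : ℂ) : fderiv ℝ (mollify f ε) x v =
      ∫ w, f w * fderiv ℝ (fun z => (mollifier ε z : ℂ)) (x - w) v := by
    rw [hder.fderiv]
    exact ContinuousLinearMap.integral_apply hconv v
  have hint (v : ℂ) : Integrable fun w =>
      f w * fderiv ℝ (fun z => (mollifier ε z : ℂ)) (x - w) v :=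
    (ContinuousLinearMap.apply ℝ ℂ v).integrable_comp hconv
  have hsupp : tsupport (fun w => (mollifier ε (x - w) : ℂ)) ⊆ closedBall x ε := by
    refine closure_minimal (fun w hw => ?_) isClosed_closedBall
    have : mollifier ε (x - w) ≠ 0 := by simpa using hw
    have := support_mollifier_subset hε this
    simpa [dist_eq_norm, norm_sub_rev] using this
  have key := hw (fun w => (mollifier ε (x - w) : ℂ)) (hsm.comp (contDiff_const.sub contDiff_id))
    ((isCompact_closedBall x _).of_isClosed_subset (isClosed_tsupport _) hsupp) (hsupp.trans hx)
  have heq : ∀ w, f w * dbar (fun w => (mollifier ε (x - w) : ℂ)) w =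
      -(f w * fderiv ℝ (fun z => (mollifier ε z : ℂ)) (x - w) 1 +
        Complex.I * (f w * fderiv ℝ (fun z => (mollifier ε z : ℂ)) (x - w) Complex.I)) := fun w => by
    rw [dbar_comp_const_sub (hsm.differentiable (by norm_num)), dbar]
    ring
  simp_rw [heq] at key
  rw [integral_neg, integral_add (hint 1) ((hint Complex.I).const_mul _), integral_const_mul,
    ← happ, ← happ, neg_eq_zero] at key
  rw [differentiableAt_complex_iff_differentiableAt_real]
  refine ⟨hder.differentiableAt, ?_⟩
  rw [smul_eq_mul]
  linear_combination -Complex.I * key + fderiv ℝ (mollify f ε) x Complex.I * Complex.I_sq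

/-- At Lebesgue points the mollifications converge, up to the mass of the mollifier. -/
theorem ae_tendsto_mollify {f : ℂ → ℂ} (hf : LocallyIntegrable f) :
    ∀ᵐ x, Tendsto (fun ε => mollify f ε x) (𝓝[>] 0)
      (𝓝 (((∫ z, mollifier 1 z : ℝ) : ℂ) * f x)) := by
  obtain ⟨M, hM0, hM⟩ := exists_mollifier_le
  filter_upwards [IsUnifLocDoublingMeasure.ae_tendsto_average_norm_sub volume hf 1] with x hx
  have hlim := hx (fun _ : ℝ => x) (fun ε : ℝ => ε) (l := 𝓝[>] 0) tendsto_id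
    (by filter_upwards [self_mem_nhdsWithin] with ε hε
        exact mem_closedBall_self (by simpa using (le_of_lt hε)))
  rw [tendsto_iff_norm_sub_tendsto_zero]
  refine squeeze_zero' (Eventually.of_forall fun _ => norm_nonneg _) ?_
    (by simpa using hlim.const_mul (M * Real.pi))
  filter_upwards [self_mem_nhdsWithin] with ε hε
  replace hε : 0 < ε := hε
  have hmass : ∫ w, f x * (mollifier ε (x - w) : ℂ) =
      ((∫ z, mollifier 1 z : ℝ) : ℂ) * f x := by
    rw [integral_const_mul, integral_sub_left_eq_self (fun w => (mollifier ε w : ℂ)),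
      integral_complex_ofReal, integral_mollifier hε, mul_comm]
  have hsub : mollify f ε x - ((∫ z, mollifier 1 z : ℝ) : ℂ) * f x =
      ∫ w, (f w - f x) * (mollifier ε (x - w) : ℂ) := by
    rw [← hmass, mollify, ← integral_sub (integrable_mul_mollifier hf hε x)
      (integrable_mul_mollifier (locallyIntegrable_const (f x)) hε x)]
    simp_rw [sub_mul]
  have hset : ∫ w, (f w - f x) * (mollifier ε (x - w) : ℂ) =
      ∫ w in closedBall x ε, (f w - f x) * (mollifier ε (x - w) : ℂ) := by
    refine (setIntegral_eq_integral_of_forall_compl_eq_zero fun w hw => ?_).symm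
    rw [mollifier_of_lt hε, Complex.ofReal_zero, mul_zero]
    rwa [mem_closedBall, not_le, dist_eq_norm, norm_sub_rev] at hw
  rw [hsub, hset]
  have hint : IntegrableOn (fun w => ‖f w - f x‖) (closedBall x ε) :=
    ((hf.integrableOn_isCompact (isCompact_closedBall x ε)).sub
      (integrableOn_const (isCompact_closedBall x ε).measure_lt_top.ne)).norm
  calc ‖∫ w in closedBall x ε, (f w - f x) * (mollifier ε (x - w) : ℂ)‖
      ≤ ∫ w in closedBall x ε, M / ε ^ 2 * ‖f w - f x‖ := by
        refine norm_integral_le_of_norm_le (hint.const_mul _) (Eventually.of_forall fun w => ?_)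
        rw [norm_mul, Complex.norm_real, Real.norm_of_nonneg (mollifier_nonneg _ _), mul_comm]
        gcongr
        exact hM ε _
    _ = M * Real.pi * ⨍ w in closedBall x ε, ‖f w - f x‖ := by
        have hvol : volume.real (closedBall x ε) = Real.pi * ε ^ 2 := by
          rw [Measure.real, Complex.volume_closedBall]
          simp [hε.le, mul_comm]
        rw [integral_const_mul, setAverage_eq, hvol, smul_eq_mul]
        field_simp

/-- **Weyl's lemma** for the Cauchy–Riemann operator: a weakly holomorphic function agrees almost
everywhere with a holomorphic one. -/
theorem IsWeaklyHolomorphic.exists_differentiableOn {f : ℂ → ℂ} {U : Set ℂ} (hU : IsOpen U)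
    (hw : IsWeaklyHolomorphic f U) (hf : LocallyIntegrable f) :
    ∃ g : ℂ → ℂ, DifferentiableOn ℂ g U ∧ ∀ᵐ x, x ∈ U → f x = g x := by
  have hr : ∀ x : ℂ, ∃ r : ℝ, x ∈ U → 0 < r ∧ closedBall x r ⊆ U := fun x => by
    by_cases hx : x ∈ U
    · obtain ⟨r, h0, h⟩ := nhds_basis_closedBall.mem_iff.1 (hU.mem_nhds hx)
      exact ⟨r, fun _ => ⟨h0, h⟩⟩
    · exact ⟨0, fun h => absurd h hx⟩
  choose r hr using hr
  set c : ℂ := ((∫ z, mollifier 1 z : ℝ) : ℂ) with hc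
  have hc0 : c ≠ 0 := Complex.ofReal_ne_zero.2 integral_mollifier_one_pos.ne'
  refine ⟨fun x => c⁻¹ * mollify f (r x) x, fun x hx => ?_, ?_⟩
  · obtain ⟨h0, hb⟩ := hr x hx
    have hloc : (fun y => c⁻¹ * mollify f (r y) y) =ᶠ[𝓝 x]
        fun y => c⁻¹ * mollify f (r x / 2) y := by
      filter_upwards [ball_mem_nhds x (half_pos h0)] with y hy
      have hsub : closedBall y (r x / 2) ⊆ U := by
        refine (closedBall_subset_closedBall' ?_).trans hb
        linarith [mem_ball.1 hy]
      have hyU : y ∈ U := hsub (mem_closedBall_self (half_pos h0).le)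
      rw [hw.mollify_eq hf (hr y hyU).1 (half_pos h0) (hr y hyU).2 hsub]
    have hd := hw.differentiableAt_mollify hf (half_pos h0)
      ((closedBall_subset_closedBall (by linarith)).trans hb)
    exact ((hd.const_mul c⁻¹).congr_of_eventuallyEq hloc).differentiableWithinAt
  · filter_upwards [ae_tendsto_mollify hf] with x hx hxU
    obtain ⟨h0, hb⟩ := hr x hxU
    have hev : (fun ε => mollify f ε x) =ᶠ[𝓝[>] 0] fun _ => mollify f (r x) x := by
      filter_upwards [Ioc_mem_nhdsGT h0] with ε hε
      exact hw.mollify_eq hf hε.1 h0 ((closedBall_subset_closedBall hε.2).trans hb) hb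
    have := tendsto_nhds_unique (hx.congr' hev) tendsto_const_nhds
    rw [← this, ← hc, inv_mul_cancel_left₀ hc0]

end

/-! ### Primitives on simply connected sets -/

section

open Filter Topology

/-- On a simply connected, locally path connected space, locally defined functions whose
differences are locally constant can be corrected by locally constant functions so as to glue
together (the first Čech cohomology with constant coefficients vanishes). The differences are the
transition functions of a bundle with discrete fibre, and a global section of this covering space
exists by lifting the identity. -/
theorem exists_gluing_of_locally_const_sub {X A ι : Type*} [TopologicalSpace X]
    [SimplyConnectedSpace X] [LocallyPathConnectedSpace X] [AddCommGroup A]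
    (U : ι → Set X) (hU : ∀ i, IsOpen (U i)) (hcov : ∀ x, ∃ i, x ∈ U i) (G : ι → X → A)
    (hG : ∀ i j, ∀ x ∈ U i ∩ U j, ∀ᶠ y in 𝓝 x, G i y - G j y = G i x - G j x) :
    ∃ F : X → A, ∀ i, ∀ x ∈ U i, ∀ᶠ y in 𝓝 x, F y - F x = G i y - G i x := by
  let _ : TopologicalSpace A := ⊥
  have : DiscreteTopology A := ⟨rfl⟩
  choose ind hind using hcov
  let Z : FiberBundleCore ι X A :=
    { baseSet := U
      isOpen_baseSet := hU
      indexAt := ind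
      mem_baseSet_at := hind
      coordChange := fun i j x a => a + (G j x - G i x)
      coordChange_self := fun i x _ a => by simp
      continuousOn_coordChange := fun i j => by
        rintro ⟨x, a⟩ ⟨hx, -⟩
        refine ContinuousAt.continuousWithinAt ?_
        have h1 : ∀ᶠ p : X × A in 𝓝 (x, a), G j p.1 - G i p.1 = G j x - G i x :=
          (continuous_fst.tendsto (x, a)).eventually (hG j i x ⟨hx.2, hx.1⟩)
        have h2 : ContinuousAt (fun p : X × A => p.2 + (G j x - G i x)) (x, a) :=
          (continuous_of_discreteTopology (f := fun b : A => b + (G j x - G i x))).continuousAt.comp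
            continuousAt_snd
        refine h2.congr ?_
        filter_upwards [h1] with p hp
        rw [hp]
      coordChange_comp := fun i j k x _ a => by abel }
  have hcm : IsCoveringMap Z.proj :=
    IsCoveringMap.mk Z.proj (fun _ => A) (fun x => Z.localTrivAt x)
      (fun x => Z.mem_localTrivAt_baseSet x)
  obtain ⟨x₀⟩ : Nonempty X := inferInstance
  obtain ⟨s, ⟨-, hs⟩, -⟩ := hcm.existsUnique_continuousMap_lifts (ContinuousMap.id X) x₀
    (⟨x₀, (0 : A)⟩ : Z.TotalSpace) rfl
  have hproj (x : X) : (s x).1 = x := congrFun hs x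
  let σ : X → A := fun x => (s x).2
  refine ⟨fun x => G (ind x) x - σ x, fun i x hx => ?_⟩
  have hcont : ContinuousAt (fun y => (Z.localTriv i (s y)).2) x := by
    have hmem : s x ∈ (Z.localTriv i).source := by
      rw [Z.mem_localTriv_source, hproj]
      exact hx
    exact continuousAt_snd.comp (((Z.localTriv i).continuousAt hmem).comp s.continuous.continuousAt)
  -- in a chart the section is locally constant, because the fibre is discrete
  have hconst : ∀ᶠ y in 𝓝 x, (Z.localTriv i (s y)).2 = (Z.localTriv i (s x)).2 := by
    have := hcont.tendsto
    rwa [nhds_discrete A, tendsto_pure] at this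
  have hval (y : X) : (Z.localTriv i (s y)).2 = σ y + (G i y - G (ind y) y) := by
    rw [Z.localTriv_apply]
    change σ y + (G i (s y).1 - G (ind (s y).1) (s y).1) = _
    rw [hproj]
  filter_upwards [hconst] with y hy
  rw [hval, hval] at hy
  calc G (ind y) y - σ y - (G (ind x) x - σ x)
      = G i y - (σ y + (G i y - G (ind y) y)) - (G (ind x) x - σ x) := by abel
    _ = G i y - (σ x + (G i x - G (ind x) x)) - (G (ind x) x - σ x) := by rw [hy]
    _ = G i y - G i x := by abel

/-- A holomorphic function on an open simply connected set has a primitive. -/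
theorem exists_primitive_of_isSimplyConnected {U : Set ℂ} (hU : IsOpen U)
    (hsc : IsSimplyConnected U) {f : ℂ → ℂ} (hf : DifferentiableOn ℂ f U) :
    ∃ F : ℂ → ℂ, ∀ z ∈ U, HasDerivAt F (f z) z := by
  classical
  have := hsc.simplyConnectedSpace
  have := hU.locallyPathConnectedSpace
  have hloc : ∀ x : U, ∃ r > 0, Metric.ball (x : ℂ) r ⊆ U ∧
      ∃ G : ℂ → ℂ, ∀ z ∈ Metric.ball (x : ℂ) r, HasDerivAt G (f z) z := fun x => by
    obtain ⟨r, hr, hb⟩ := Metric.isOpen_iff.1 hU x x.2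
    exact ⟨r, hr, hb, (hf.mono hb).isExactOn_ball⟩
  choose r hr hb G hG using hloc
  obtain ⟨F, hF⟩ := exists_gluing_of_locally_const_sub (X := U)
    (fun x : U => Subtype.val ⁻¹' Metric.ball (x : ℂ) (r x))
    (fun x => Metric.isOpen_ball.preimage continuous_subtype_val)
    (fun x => ⟨x, Metric.mem_ball_self (hr x)⟩) (fun x y => G x y) (by
      rintro i j x ⟨hi, hj⟩
      obtain ⟨ε, hε, hsub⟩ := Metric.isOpen_iff.1
        (Metric.isOpen_ball.inter Metric.isOpen_ball) (x : ℂ) ⟨hi, hj⟩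
      have hmem : Subtype.val ⁻¹' Metric.ball (x : ℂ) ε ∈ 𝓝 x :=
        continuous_subtype_val.continuousAt.preimage_mem_nhds (Metric.ball_mem_nhds _ hε)
      filter_upwards [hmem] with y hy
      have hd : ∀ z ∈ Metric.ball (x : ℂ) ε, HasDerivAt (fun z => G i z - G j z) 0 z :=
        fun z hz => by
          simpa using (hG i z (hsub hz).1).fun_sub (hG j z (hsub hz).2)
      exact Metric.isOpen_ball.is_const_of_deriv_eq_zero
        (convex_ball _ _).isPreconnected
        (fun z hz => (hd z hz).differentiableAt.differentiableWithinAt)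
        (fun z hz => (hd z hz).deriv) hy (Metric.mem_ball_self hε))
  refine ⟨fun z => if hz : z ∈ U then F ⟨z, hz⟩ else 0, fun z hz => ?_⟩
  have h1 := hF ⟨z, hz⟩ ⟨z, hz⟩ (Metric.mem_ball_self (hr _))
  rw [nhds_subtype_eq_comap, eventually_comap] at h1
  refine (((hG ⟨z, hz⟩ z (Metric.mem_ball_self (hr _))).sub_const (G ⟨z, hz⟩ z)).add_const
    (F ⟨z, hz⟩)).congr_of_eventuallyEq ?_
  filter_upwards [h1, hU.mem_nhds hz] with y hy hyU
  rw [dif_pos hyU, ← hy ⟨y, hyU⟩ rfl, sub_add_cancel]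

end

/-! ### Fields without curl, divergence and tangential trace -/

section

open Filter Topology

/-- A function with square-integrable classical directional derivatives has them as weak
derivatives. No continuity of the derivative is needed. -/
theorem isWeakPartial_toLp {i : Fin 2} {u u' : Plane → ℂ}
    (hu : MemLp u 2 (volume.restrict (D : Set Plane)))
    (hu' : MemLp u' 2 (volume.restrict (D : Set Plane)))
    (h : ∀ x ∈ D, HasLineDerivAt ℝ u (u' x) x (dir i)) :
    IsWeakPartial D i (hu.toLp u) (hu'.toLp u') := fun χ => by
  have hinner {η : 𝓓(D, ℂ)} {w : Plane → ℂ} (hw : MemLp w 2 (volume.restrict (D : Set Plane))) :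
      inner ℂ (testToL2 D η) (hw.toLp w) = ∫ x, (starRingEnd ℂ) (η x) * w x ∧
        Integrable fun x => (starRingEnd ℂ) (η x) * w x := by
    have hae : (fun x => inner ℂ ((testToL2 D η : L2 D) x) ((hw.toLp w : L2 D) x)) =ᵐ[
        volume.restrict (D : Set Plane)] fun x => (starRingEnd ℂ) (η x) * w x := by
      filter_upwards [(testFunction_memLp D η).coeFn_toLp, hw.coeFn_toLp] with x h1 h2
      have h1' : (testToL2 D η : L2 D) x = η x := h1
      rw [h1', h2]
      simp [mul_comm]
    have hsupp : Function.support (fun x => (starRingEnd ℂ) (η x) * w x) ⊆ D := fun x hx => by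
      refine η.tsupport_subset (subset_tsupport _ fun h0 => hx ?_)
      simp [h0]
    constructor
    · rw [L2.inner_def, integral_congr_ae hae]
      refine setIntegral_eq_integral_of_forall_compl_eq_zero fun x hx => ?_
      by_contra h0
      exact hx (hsupp h0)
    · rw [← integrableOn_iff_integrable_of_support_subset hsupp]
      exact (L2.integrable_inner (𝕜 := ℂ) (testToL2 D η) (hw.toLp w)).congr hae
  have hd : ∀ x, HasLineDerivAt ℝ (fun x => (starRingEnd ℂ) (χ x))
      ((starRingEnd ℂ) ((∂_{dir i} χ) x)) x (dir i) := fun x => by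
    rw [lineDerivOp_apply]
    have h1 : HasFDerivAt χ (fderiv ℝ χ x) x :=
      (χ.contDiff.differentiable (by norm_num) x).hasFDerivAt
    exact (Complex.conjCLE.toContinuousLinearMap.hasFDerivAt.comp x h1).hasLineDerivAt (dir i)
  have key := integral_bilinear_hasLineDerivAt_right_eq_neg_left_of_integrable
    (f := fun x => (starRingEnd ℂ) (χ x)) (f' := fun x => (starRingEnd ℂ) ((∂_{dir i} χ) x))
    (g := u) (g' := u') (v := dir i) (B := ContinuousLinearMap.mul ℝ ℂ) (μ := volume)
    (hinner hu).2 (hinner hu').2 (hinner hu).2 (fun x _ => hd x)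
    (fun x hx => h x (χ.tsupport_subset (by
      refine closure_mono (fun y hy => ?_) hx
      simpa using hy)))
  rw [(hinner hu).1, (hinner hu').1]
  have key' : ∫ x, (starRingEnd ℂ) (χ x) * u' x =
    -∫ x, (starRingEnd ℂ) ((∂_{dir i} χ) x) * u x := key
  rw [key', neg_neg]

/-- The real part of the `L²` inner product with a real-valued function. -/
theorem re_inner_toLp_ofReal {r : Plane → ℝ}
    (hr : MemLp (fun x => (r x : ℂ)) 2 (volume.restrict (D : Set Plane))) (u : L2 D) :
    (inner ℂ (hr.toLp fun x => (r x : ℂ)) u).re = ∫ x in (D : Set Plane), r x * (u x).re ∧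
      IntegrableOn (fun x => r x * (u x).re) D := by
  have hae : (fun x => (inner ℂ ((hr.toLp fun x => (r x : ℂ)) x) (u x)).re) =ᵐ[
      volume.restrict (D : Set Plane)] fun x => r x * (u x).re := by
    filter_upwards [hr.coeFn_toLp] with x h1
    rw [h1]
    simp [mul_comm]
  have hint := L2.integrable_inner (𝕜 := ℂ) (hr.toLp fun x => (r x : ℂ)) u
  refine ⟨?_, hint.re.congr hae⟩
  rw [L2.inner_def, ← integral_congr_ae hae]
  exact (integral_re hint).symm

/-- The isometry of `ℂ` with the Euclidean plane. -/
abbrev planeEquiv : ℂ ≃ₗᵢ[ℝ] Plane := Complex.orthonormalBasisOneI.repr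

theorem planeEquiv_symm_dir_zero : planeEquiv.symm (dir 0) = 1 := by simp [dir]

theorem planeEquiv_symm_dir_one : planeEquiv.symm (dir 1) = Complex.I := by simp [dir]

/-- The complex function `Re E₁ - i Re E₂` on `D ⊆ ℂ`, extended by zero: the Cauchy–Riemann
equations for it are `div Re E = 0` and `curl Re E = 0`. -/
def complexField (D : Opens Plane) (E : VecL2 D) : ℂ → ℂ :=
  (planeEquiv ⁻¹' (D : Set Plane)).indicator fun z =>
    ((E 0 (planeEquiv z)).re : ℂ) - Complex.I * ((E 1 (planeEquiv z)).re : ℂ)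

theorem measurePreserving_planeEquiv_restrict : MeasurePreserving planeEquiv
    (volume.restrict (planeEquiv ⁻¹' (D : Set Plane))) (volume.restrict (D : Set Plane)) :=
  planeEquiv.measurePreserving.restrict_preimage_emb
    planeEquiv.toHomeomorph.measurableEmbedding _

theorem integral_comp_planeEquiv (h : Plane → ℂ) :
    ∫ z in planeEquiv ⁻¹' (D : Set Plane), h (planeEquiv z) = ∫ x in (D : Set Plane), h x :=
  measurePreserving_planeEquiv_restrict.integral_comp
    planeEquiv.toHomeomorph.measurableEmbedding h

theorem isOpen_preimage_planeEquiv : IsOpen (planeEquiv ⁻¹' (D : Set Plane)) :=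
  D.isOpen.preimage planeEquiv.continuous

theorem integrable_complexField (hbdd : Bornology.IsBounded (D : Set Plane)) (E : VecL2 D) :
    Integrable (complexField D E) := by
  have hfin : IsFiniteMeasure (volume.restrict (D : Set Plane)) :=
    ⟨by simpa using hbdd.measure_lt_top⟩
  have h (i : Fin 2) : Integrable (fun x => ((E i x).re : ℂ)) (volume.restrict (D : Set Plane)) :=
    ((Lp.memLp (E i)).integrable (by norm_num)).re.ofReal
  have h2 := measurePreserving_planeEquiv_restrict.integrable_comp_of_integrable
    ((h 0).sub ((h 1).const_mul Complex.I))
  exact (integrable_indicator_iff isOpen_preimage_planeEquiv.measurableSet).2 h2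

theorem isWeaklyHolomorphic_of_real {f : ℂ → ℂ} {U : Set ℂ} (hf : LocallyIntegrable f)
    (h : ∀ a : ℂ → ℝ, ContDiff ℝ (⊤ : ℕ∞) a → HasCompactSupport a → tsupport a ⊆ U →
      ∫ w, f w * dbar (fun z => (a z : ℂ)) w = 0) : IsWeaklyHolomorphic f U := by
  intro χ hχ hc hs
  have hre : ContDiff ℝ (⊤ : ℕ∞) fun z => (χ z).re := Complex.reCLM.contDiff.comp hχ
  have him : ContDiff ℝ (⊤ : ℕ∞) fun z => (χ z).im := Complex.imCLM.contDiff.comp hχ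
  have hcre : HasCompactSupport fun z => (χ z).re := hc.comp_left (g := Complex.re) rfl
  have hcim : HasCompactSupport fun z => (χ z).im := hc.comp_left (g := Complex.im) rfl
  have hint {a : ℂ → ℝ} (ha : ContDiff ℝ (⊤ : ℕ∞) a) (hca : HasCompactSupport a) :
      Integrable fun w => f w * dbar (fun z => (a z : ℂ)) w := by
    have ha' : ContDiff ℝ (⊤ : ℕ∞) fun z => (a z : ℂ) := Complex.ofRealCLM.contDiff.comp ha
    have hc' : HasCompactSupport (fderiv ℝ fun z => (a z : ℂ)) :=
      (hca.comp_left (g := ((↑) : ℝ → ℂ)) Complex.ofReal_zero).fderiv ℝ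
    have hcont : Continuous (fderiv ℝ fun z => (a z : ℂ)) :=
      ha'.continuous_fderiv (by norm_num)
    have hcd : HasCompactSupport (dbar fun z => (a z : ℂ)) :=
      hc'.comp_left (g := fun L : ℂ →L[ℝ] ℂ => L 1 + Complex.I * L Complex.I) (by simp)
    have := hf.integrable_smul_left_of_hasCompactSupport
      (g := dbar fun z => (a z : ℂ)) (by unfold dbar; fun_prop) hcd
    simpa [mul_comm] using this
  have hsplit (w : ℂ) : f w * dbar χ w = f w * dbar (fun z => ((χ z).re : ℂ)) w +
      Complex.I * (f w * dbar (fun z => ((χ z).im : ℂ)) w) := by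
    have h1 : DifferentiableAt ℝ (fun z => ((χ z).re : ℂ)) w :=
      (Complex.ofRealCLM.contDiff.comp hre).differentiable (by norm_num) w
    have h2 : DifferentiableAt ℝ (fun z => ((χ z).im : ℂ)) w :=
      (Complex.ofRealCLM.contDiff.comp him).differentiable (by norm_num) w
    have h3 : χ = fun z => ((χ z).re : ℂ) + Complex.I * ((χ z).im : ℂ) := by
      funext z
      rw [mul_comm, Complex.re_add_im]
    have h4 : fderiv ℝ χ w = fderiv ℝ (fun z => ((χ z).re : ℂ)) w +
        Complex.I • fderiv ℝ (fun z => ((χ z).im : ℂ)) w := by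
      conv_lhs => rw [h3]
      exact (h1.hasFDerivAt.add (h2.hasFDerivAt.const_mul Complex.I)).fderiv
    simp only [dbar, h4, add_apply, smul_apply, smul_eq_mul]
    ring
  simp_rw [hsplit]
  have hsre : tsupport (fun z => (χ z).re) ⊆ U :=
    (tsupport_comp_subset (g := Complex.re) rfl χ).trans hs
  have hsim : tsupport (fun z => (χ z).im) ⊆ U :=
    (tsupport_comp_subset (g := Complex.im) rfl χ).trans hs
  rw [integral_add (hint hre hcre) ((hint him hcim).const_mul _), integral_const_mul,
    h _ hre hcre hsre, h _ him hcim hsim, mul_zero, add_zero]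

theorem isWeaklyHolomorphic_complexField (hbdd : Bornology.IsBounded (D : Set Plane))
    {E : VecL2 D} (hcurl : HasCurl D E 0) (hdiv : HasDiv D E 0) :
    IsWeaklyHolomorphic (complexField D E) (planeEquiv ⁻¹' (D : Set Plane)) := by
  refine isWeaklyHolomorphic_of_real (integrable_complexField hbdd E).locallyIntegrable ?_
  intro a ha hc hs
  have hts : tsupport (fun x => (a (planeEquiv.symm x) : ℂ)) ⊆ planeEquiv.symm ⁻¹' tsupport a := by
    refine closure_minimal (fun x hx => subset_tsupport _ ?_)
      ((isClosed_tsupport a).preimage planeEquiv.symm.continuous)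
    simpa using hx
  have hsub : planeEquiv.symm ⁻¹' tsupport a ⊆ D := fun x hx => by
    have := hs hx
    rwa [Set.mem_preimage, planeEquiv.apply_symm_apply] at this
  have hdiff : Differentiable ℝ a := ha.differentiable (by norm_num)
  let χ : 𝓓(D, ℂ) :=
    { toFun := fun x => (a (planeEquiv.symm x) : ℂ)
      contDiff' := Complex.ofRealCLM.contDiff.comp (ha.comp planeEquiv.symm.contDiff)
      hasCompactSupport' := by
        refine IsCompact.of_isClosed_subset ?_ (isClosed_tsupport _) hts
        exact planeEquiv.symm.toHomeomorph.isCompact_preimage.2 hc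
      tsupport_subset' := hts.trans hsub }
  let A : Fin 2 → Plane → ℝ := fun i x =>
    fderiv ℝ a (planeEquiv.symm x) (planeEquiv.symm (dir i))
  have hA (i : Fin 2) : ((∂_{dir i} χ : 𝓓(D, ℂ)) : Plane → ℂ) = fun x => (A i x : ℂ) := by
    funext x
    rw [lineDerivOp_apply]
    have h1 : HasFDerivAt χ _ x := Complex.ofRealCLM.hasFDerivAt.comp x
      ((hdiff (planeEquiv.symm x)).hasFDerivAt.comp x
        planeEquiv.symm.toContinuousLinearEquiv.hasFDerivAt)
    rw [h1.fderiv]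
    rfl
  have hm (i : Fin 2) : MemLp (fun x => (A i x : ℂ)) 2 (volume.restrict (D : Set Plane)) := by
    rw [← hA]
    exact testFunction_memLp D _
  have htest (i : Fin 2) : testToL2 D (∂_{dir i} χ) = (hm i).toLp _ :=
    MemLp.toLp_congr (testFunction_memLp D _) (hm i) (by rw [hA])
  have h1 := congrArg Complex.re (hdiv χ)
  have h2 := congrArg Complex.re (hcurl χ)
  rw [htest, htest, inner_zero_right, neg_zero, Complex.add_re, (re_inner_toLp_ofReal _ _).1,
    (re_inner_toLp_ofReal _ _).1, Complex.zero_re] at h1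
  rw [htest, htest, inner_zero_right, Complex.sub_re, (re_inner_toLp_ofReal _ _).1,
    (re_inner_toLp_ofReal _ _).1, Complex.zero_re] at h2
  have hI (i j : Fin 2) := (re_inner_toLp_ofReal (hm i) (E j)).2
  have hdbar (z : ℂ) : dbar (fun z => (a z : ℂ)) z =
      (A 0 (planeEquiv z) : ℂ) + Complex.I * (A 1 (planeEquiv z) : ℂ) := by
    have h1 : HasFDerivAt (fun z => (a z : ℂ)) _ z :=
      Complex.ofRealCLM.hasFDerivAt.comp z (hdiff z).hasFDerivAt
    simp only [dbar, h1.fderiv, A, planeEquiv_symm_dir_zero, planeEquiv_symm_dir_one,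
      LinearIsometryEquiv.symm_apply_apply]
    rfl
  have hset : ∫ w, complexField D E w * dbar (fun z => (a z : ℂ)) w =
      ∫ x in (D : Set Plane),
        (((A 0 x * (E 0 x).re + A 1 x * (E 1 x).re : ℝ) : ℂ) +
          Complex.I * ((A 1 x * (E 0 x).re - A 0 x * (E 1 x).re : ℝ) : ℂ)) := by
    rw [← integral_comp_planeEquiv, ← integral_indicator isOpen_preimage_planeEquiv.measurableSet]
    congr 1
    funext z
    by_cases hz : z ∈ planeEquiv ⁻¹' (D : Set Plane)
    · rw [complexField, Set.indicator_of_mem hz, Set.indicator_of_mem hz, hdbar]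
      push_cast
      linear_combination (-(E 1 (planeEquiv z)).re * (A 1 (planeEquiv z) : ℂ)) * Complex.I_sq
    · rw [complexField, Set.indicator_of_notMem hz, Set.indicator_of_notMem hz, zero_mul]
  rw [hset, integral_add (((hI 0 0).add (hI 1 1)).ofReal)
    ((((hI 1 0).sub (hI 0 1)).ofReal).const_mul _), integral_const_mul]
  rw [integral_complex_ofReal, integral_complex_ofReal, integral_add (hI 0 0) (hI 1 1),
    integral_sub (hI 1 0) (hI 0 1), h1, h2]
  simp

theorem hasLineDerivAt_arctan_im {G : ℂ → ℂ} {g' : ℂ} {x : Plane}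
    (h : HasDerivAt G g' (planeEquiv.symm x)) (v : Plane) :
    HasLineDerivAt ℝ (fun x => (Real.arctan (G (planeEquiv.symm x)).im : ℂ))
      ((1 / (1 + (G (planeEquiv.symm x)).im ^ 2) * (g' * planeEquiv.symm v).im : ℝ) : ℂ) x v := by
  have h1 : HasFDerivAt G _ (planeEquiv.symm x) := h.hasFDerivAt.restrictScalars ℝ
  have h2 : HasFDerivAt (fun x => (G (planeEquiv.symm x)).im) _ x :=
    Complex.imCLM.hasFDerivAt.comp x
      (h1.comp x planeEquiv.symm.toContinuousLinearEquiv.hasFDerivAt)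
  have h3 := (Complex.ofRealCLM.hasFDerivAt.comp x
    ((Real.hasDerivAt_arctan _).comp_hasFDerivAt x h2)).hasLineDerivAt v
  refine Eq.mp (congrArg (fun L => HasLineDerivAt ℝ _ L x v) ?_) h3
  rw [mul_comm g']
  rfl

/-- The real part of a field without curl and divergence is, on a simply connected domain, the
rotated gradient of a function `w`. Testing with `arctan w`, which is bounded and so lies in `H¹(D)`
although `w` need not, shows that it vanishes if the tangential trace does. -/
theorem re_ae_eq_zero_of_hasCurl_of_hasDiv (hbdd : Bornology.IsBounded (D : Set Plane))
    (hsc : SimplyConnectedSpace D) {E : VecL2 D} (hcurl : HasCurl D E 0) (hdiv : HasDiv D E 0)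
    (htr : ∀ v : H1 D, vecInner D (vcurl D v) E = 0) :
    ∀ᵐ x ∂(volume.restrict (D : Set Plane)), (E 0 x).re = 0 ∧ (E 1 x).re = 0 := by
  have hfin : IsFiniteMeasure (volume.restrict (D : Set Plane)) :=
    ⟨by simpa using hbdd.measure_lt_top⟩
  obtain ⟨g, hg, hfg⟩ := (isWeaklyHolomorphic_complexField hbdd hcurl hdiv).exists_differentiableOn
    isOpen_preimage_planeEquiv (integrable_complexField hbdd E).locallyIntegrable
  obtain ⟨G, hG⟩ := exists_primitive_of_isSimplyConnected isOpen_preimage_planeEquiv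
    (planeEquiv.toHomeomorph.isSimplyConnected_preimage.2 hsc) hg
  -- almost everywhere, `g = Re E₁ - i Re E₂`
  have hgE : ∀ᵐ x ∂(volume.restrict (D : Set Plane)),
      (g (planeEquiv.symm x)).re = (E 0 x).re ∧ (g (planeEquiv.symm x)).im = -(E 1 x).re := by
    rw [ae_restrict_iff' D.isOpen.measurableSet]
    filter_upwards [planeEquiv.symm.measurePreserving.quasiMeasurePreserving.ae hfg] with x hx hxD
    have hmem : planeEquiv.symm x ∈ planeEquiv ⁻¹' (D : Set Plane) := by
      rwa [Set.mem_preimage, planeEquiv.apply_symm_apply]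
    have := hx hmem
    rw [complexField, Set.indicator_of_mem hmem, planeEquiv.apply_symm_apply] at this
    rw [← this]
    simp
  set w : Plane → ℝ := fun x => (G (planeEquiv.symm x)).im with hw
  set F : Plane → ℝ := fun x => 1 / (1 + w x ^ 2) with hF
  have hF0 (x : Plane) : 0 < F x := by positivity
  have hF1 (x : Plane) : F x ≤ 1 := by
    rw [hF]
    exact (div_le_one (by positivity)).2 (by nlinarith [sq_nonneg (w x)])
  have hmap : Set.MapsTo planeEquiv.symm (D : Set Plane) (planeEquiv ⁻¹' (D : Set Plane)) :=
    fun x hx => by rwa [Set.mem_preimage, planeEquiv.apply_symm_apply]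
  have hGc : ContinuousOn (fun x => G (planeEquiv.symm x)) (D : Set Plane) :=
    ContinuousOn.comp (fun z hz => (hG z hz).continuousAt.continuousWithinAt)
      planeEquiv.symm.continuous.continuousOn hmap
  have hgc : ContinuousOn (fun x => g (planeEquiv.symm x)) (D : Set Plane) :=
    hg.continuousOn.comp planeEquiv.symm.continuous.continuousOn hmap
  have hwc : ContinuousOn w (D : Set Plane) := Complex.continuous_im.comp_continuousOn hGc
  have hFc : ContinuousOn F (D : Set Plane) :=
    continuousOn_const.div (continuousOn_const.add (hwc.pow 2)) fun x _ => by positivity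
  -- the partial derivatives of `arctan w`
  set r : Fin 2 → Plane → ℝ := fun i x =>
    F x * (g (planeEquiv.symm x) * planeEquiv.symm (dir i)).im with hr
  have hr0 (x : Plane) : r 0 x = F x * (g (planeEquiv.symm x)).im := by
    simp only [hr, planeEquiv_symm_dir_zero, mul_one]
  have hr1 (x : Plane) : r 1 x = F x * (g (planeEquiv.symm x)).re := by
    simp only [hr, planeEquiv_symm_dir_one, Complex.mul_I_im]
  have hv : MemLp (fun x => (Real.arctan (w x) : ℂ)) 2 (volume.restrict (D : Set Plane)) := by
    refine MemLp.of_bound ((Complex.continuous_ofReal.comp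
      Real.continuous_arctan).comp_continuousOn hwc |>.aestronglyMeasurable
        D.isOpen.measurableSet) (Real.pi / 2) (Eventually.of_forall fun x => ?_)
    rw [Complex.norm_real, Real.norm_eq_abs]
    exact abs_le.2 ⟨(Real.neg_pi_div_two_lt_arctan _).le, (Real.arctan_lt_pi_div_two _).le⟩
  have hrm (i : Fin 2) : MemLp (fun x => (r i x : ℂ)) 2 (volume.restrict (D : Set Plane)) := by
    have hmeas : AEStronglyMeasurable (fun x => (r i x : ℂ)) (volume.restrict (D : Set Plane)) := by
      refine (Complex.continuous_ofReal.comp_continuousOn (hFc.mul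
        (Complex.continuous_im.comp_continuousOn (hgc.mul
          continuousOn_const)))).aestronglyMeasurable D.isOpen.measurableSet
    have hle (t : ℝ) (z : ℂ) (x : Plane) (ht : |t| = |z.re|) : ‖((F x * t : ℝ) : ℂ)‖ ≤ ‖z‖ := by
      rw [Complex.norm_real, Real.norm_eq_abs, abs_mul, abs_of_pos (hF0 x), ht]
      exact (mul_le_of_le_one_left (abs_nonneg _) (hF1 x)).trans (Complex.abs_re_le_norm z)
    fin_cases i
    · refine (Lp.memLp (E 1)).mono hmeas ?_
      filter_upwards [hgE] with x hx
      change ‖((r 0 x : ℝ) : ℂ)‖ ≤ _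
      rw [hr0, hx.2]
      exact hle _ _ x (abs_neg _)
    · refine (Lp.memLp (E 0)).mono hmeas ?_
      filter_upwards [hgE] with x hx
      change ‖((r 1 x : ℝ) : ℂ)‖ ≤ _
      rw [hr1, hx.1]
      exact hle _ _ x rfl
  have hder (i : Fin 2) (x : Plane) (hx : x ∈ D) :
      HasLineDerivAt ℝ (fun x => (Real.arctan (w x) : ℂ)) (r i x : ℂ) x (dir i) :=
    hasLineDerivAt_arctan_im (hG _ (hmap hx)) (dir i)
  have hweak (i : Fin 2) : IsWeakPartial D i (hv.toLp _) ((hrm i).toLp _) :=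
    isWeakPartial_toLp hv (hrm i) (hder i)
  let V : H1 D := ⟨hv.toLp _, fun i => ⟨_, hweak i⟩⟩
  have hV (i : Fin 2) : weakPartial D i V = (hrm i).toLp _ :=
    (weakPartial_spec D i V).unique (hweak i)
  have hpair := congrArg Complex.re (htr V)
  rw [vecInner, vcurl_zero, vcurl_one, hV, hV, inner_neg_left, Complex.add_re, Complex.neg_re,
    (re_inner_toLp_ofReal _ _).1, (re_inner_toLp_ofReal _ _).1, Complex.zero_re,
    ← sub_eq_add_neg,
    ← integral_sub (re_inner_toLp_ofReal (hrm 1) _).2 (re_inner_toLp_ofReal (hrm 0) _).2] at hpair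
  have hae : (fun x => r 1 x * (E 0 x).re - r 0 x * (E 1 x).re) =ᵐ[
      volume.restrict (D : Set Plane)] fun x => F x * ((E 0 x).re ^ 2 + (E 1 x).re ^ 2) := by
    filter_upwards [hgE] with x hx
    rw [hr0, hr1, hx.1, hx.2]
    ring
  rw [integral_congr_ae hae, integral_eq_zero_iff_of_nonneg
    (fun x => mul_nonneg (hF0 x).le (by positivity))
    (((re_inner_toLp_ofReal (hrm 1) (E 0)).2.sub
      (re_inner_toLp_ofReal (hrm 0) (E 1)).2).congr hae)] at hpair
  filter_upwards [hpair] with x hx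
  have h0 : (E 0 x).re ^ 2 + (E 1 x).re ^ 2 = 0 := (mul_eq_zero.1 hx).resolve_left (hF0 x).ne'
  constructor <;> nlinarith [sq_nonneg (E 0 x).re, sq_nonneg (E 1 x).re]

/-- On a bounded simply connected domain, a field with vanishing curl, divergence and tangential
trace is zero. -/
theorem eq_zero_of_hasCurl_of_hasDiv (hbdd : Bornology.IsBounded (D : Set Plane))
    (hsc : SimplyConnectedSpace D) {E : VecL2 D} (hcurl : HasCurl D E 0) (hdiv : HasDiv D E 0)
    (htr : ∀ v : H1 D, vecInner D (vcurl D v) E = 0) : E = 0 := by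
  have h1 := re_ae_eq_zero_of_hasCurl_of_hasDiv hbdd hsc hcurl hdiv htr
  -- the imaginary part of `E` is the real part of `-i E`
  have h2 := re_ae_eq_zero_of_hasCurl_of_hasDiv hbdd hsc (E := (-Complex.I) • E)
    (by simpa using hcurl.smul (-Complex.I)) (by simpa using hdiv.smul (-Complex.I))
    (fun v => by rw [vecInner_smul, htr, mul_zero])
  funext i
  refine Lp.ext ?_
  filter_upwards [h1, h2, Lp.coeFn_zero ℂ 2 (volume.restrict (D : Set Plane)),
    Lp.coeFn_smul (-Complex.I) (E 0), Lp.coeFn_smul (-Complex.I) (E 1)] with x h1 h2 h3 h4 h5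
  rw [Pi.smul_apply, Pi.smul_apply, h4, h5] at h2
  rw [Pi.zero_apply, h3]
  refine Complex.ext ?_ ?_
  · fin_cases i
    · simpa using h1.1
    · simpa using h1.2
  · fin_cases i
    · simpa using h2.1
    · simpa using h2.2

end

/-! ### The electric eigenspaces -/

/-- The eigenvalue equation for `β² = ω² - k`, solved for the field. -/
theorem eigenEquation_iff {ω : ℝ} {k : ℂ} {E : VecL2 D} {c d : H1 D} :
    vcurl D c - (ω : ℂ) ^ 2 • E - grad D d = -(((ω : ℂ) ^ 2 - k) • E) ↔
      k • E = vcurl D c - grad D d := by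
  rw [sub_smul]
  constructor <;> intro h
  · linear_combination (norm := module) -h
  · linear_combination (norm := module) -h

theorem inner_H1_self (u : H1 D) : inner ℂ (u : L2 D) (u : L2 D) = ((‖(u : L2 D)‖ ^ 2 : ℝ) : ℂ) := by
  simp [inner_self_eq_norm_sq_to_K]

/-- A number `k` with `‖∇u‖² = k ‖u‖²` for a nonzero `u` is real and nonnegative. -/
theorem exists_eq_ofReal_of_rayleigh {k : ℂ} {u : H1 D} (hu : u ≠ 0)
    (h : vecInner D (grad D u) (grad D u) = k * inner ℂ (u : L2 D) (u : L2 D)) :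
    ∃ m : ℝ, 0 ≤ m ∧ k = m := by
  have hn : 0 < ‖(u : L2 D)‖ ^ 2 := by
    have : (u : L2 D) ≠ 0 := fun h0 => hu (Subtype.ext h0)
    positivity
  rw [vecInner_self, inner_H1_self] at h
  refine ⟨(‖grad D u 0‖ ^ 2 + ‖grad D u 1‖ ^ 2) / ‖(u : L2 D)‖ ^ 2, by positivity, ?_⟩
  rw [Complex.ofReal_div, h, mul_div_cancel_right₀]
  exact Complex.ofReal_ne_zero.2 hn.ne'

/-- If `k E = ∇ × c - ∇ d` is an electric eigenfield with `c = curl E`, then `c` is a weak Neumann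
eigenfunction. -/
theorem neumann_of_electric {k : ℂ} {E : VecL2 D} {c d : H1 D}
    (hc : HasCurlZeroTrace D E c) (hd0 : d ∈ H10 D) (hE : k • E = vcurl D c - grad D d)
    (v : H1 D) : vecInner D (grad D v) (grad D c) = k * inner ℂ (v : L2 D) (c : L2 D) := by
  rw [hc.2 v, ← vecInner_smul, hE, vecInner_sub, vecInner_vcurl_vcurl,
    vecInner_vcurl_grad hd0, sub_zero]

/-- If `k E = ∇ × c - ∇ d` is an electric eigenfield with `d = div E`, then `d` is a weak Dirichlet
eigenfunction. -/
theorem dirichlet_of_electric {k : ℂ} {E : VecL2 D} {c d : H1 D}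
    (hd : HasDiv D E d) (hE : k • E = vcurl D c - grad D d) {v : H1 D} (hv : v ∈ H10 D) :
    vecInner D (grad D v) (grad D d) = k * inner ℂ (v : L2 D) (d : L2 D) := by
  have h1 : k * vecInner D (grad D v) E = -vecInner D (grad D v) (grad D d) := by
    rw [← vecInner_smul, hE, vecInner_sub, vecInner_grad_vcurl hv, zero_sub]
  rw [hd.vecInner_grad hv] at h1
  linear_combination h1

theorem dirichletEigenvalue_pos (hbdd : Bornology.IsBounded (D : Set Plane)) {lam : ℝ}
    (h : IsDirichletEigenvalue D lam) : 0 < lam := by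
  obtain ⟨φ, hφ, hne⟩ := Submodule.exists_mem_ne_zero_of_ne_bot h
  obtain ⟨m, hm, hlm⟩ := exists_eq_ofReal_of_rayleigh hne (hφ.2 φ hφ.1)
  have hlm' : lam = m := by exact_mod_cast hlm
  rw [hlm']
  refine lt_of_le_of_ne hm fun h0 => hne ?_
  refine eq_zero_of_mem_H10_of_grad_eq_zero hbdd hφ.1 (vecInner_self_eq_zero.1 ?_)
  rw [hφ.2 φ hφ.1, hlm, ← h0]
  simp

/-- At `β² = ω²` there is no electric eigenfield. This is where the topology of `D` enters. -/
theorem electricEigenspace_sq_eq_bot (hbdd : Bornology.IsBounded (D : Set Plane))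
    (hsc : SimplyConnectedSpace D) (ω : ℝ) : electricEigenspace D ω ((ω : ℂ) ^ 2 - 0) = ⊥ := by
  refine (Submodule.eq_bot_iff _).2 ?_
  rintro E ⟨c, d, hc, hd, hd0, hE⟩
  rw [eigenEquation_iff] at hE
  have hc0 : grad D c = 0 := by
    refine vecInner_self_eq_zero.1 ?_
    rw [neumann_of_electric hc hd0 hE, zero_mul]
  have hdz : d = 0 := by
    refine eq_zero_of_mem_H10_of_grad_eq_zero hbdd hd0 (vecInner_self_eq_zero.1 ?_)
    rw [dirichlet_of_electric hd hE hd0, zero_mul]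
  have hcz : (c : L2 D) = 0 := by
    rw [← inner_self_eq_zero (𝕜 := ℂ), hc.2 c, vcurl_eq_zero_iff.2 hc0]
    simp [vecInner]
  rw [hdz] at hd
  rw [hcz] at hc
  refine eq_zero_of_hasCurl_of_hasDiv hbdd hsc hc.1 (by simpa using hd) fun v => ?_
  rw [← hc.2 v, inner_zero_right]

theorem isWeakPartial_testToL2 (i : Fin 2) (χ : 𝓓(D, ℂ)) :
    IsWeakPartial D i (testToL2 D χ) (testToL2 D (∂_{dir i} χ)) :=
  isWeakPartial_toLp (testFunction_memLp D χ) (testFunction_memLp D (∂_{dir i} χ)) fun x _ => by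
    rw [lineDerivOp_apply]
    exact (χ.contDiff.differentiable (by norm_num) x).hasFDerivAt.hasLineDerivAt (dir i)

/-- A test function as an element of `H¹(D)`. -/
def testToH1 (D : Opens Plane) (χ : 𝓓(D, ℂ)) : H1 D :=
  ⟨testToL2 D χ, fun i => ⟨_, isWeakPartial_testToL2 i χ⟩⟩

theorem weakPartial_testToH1 (i : Fin 2) (χ : 𝓓(D, ℂ)) :
    weakPartial D i (testToH1 D χ) = testToL2 D (∂_{dir i} χ) :=
  (weakPartial_spec D i _).unique (isWeakPartial_testToL2 i χ)

theorem grad_testToH1 (χ : 𝓓(D, ℂ)) :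
    grad D (testToH1 D χ) = fun i => testToL2 D (∂_{dir i} χ) := by
  funext i
  fin_cases i
  · exact weakPartial_testToH1 0 χ
  · exact weakPartial_testToH1 1 χ

theorem testToH1_mem_H10 (χ : 𝓓(D, ℂ)) : testToH1 D χ ∈ H10 D := by
  have h : ((testToH1 D χ : L2 D), grad D (testToH1 D χ)) ∈ testGraph D :=
    ⟨χ, by rw [grad_testToH1]; rfl⟩
  exact (testGraph D).le_topologicalClosure h

/-- Green's formula against `H¹(D)` contains the distributional equation. -/
theorem hasCurlZeroTrace_of_green {E : VecL2 D} {c : L2 D}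
    (h : ∀ v : H1 D, inner ℂ (v : L2 D) c = vecInner D (vcurl D v) E) :
    HasCurlZeroTrace D E c := by
  refine ⟨fun χ => ?_, h⟩
  have := h (testToH1 D χ)
  rw [vecInner, vcurl_zero, vcurl_one, weakPartial_testToH1, weakPartial_testToH1,
    inner_neg_left, ← sub_eq_add_neg] at this
  exact this.symm

/-- Green's formula against `H¹₀(D)` contains the distributional equation. -/
theorem hasDiv_of_green {E : VecL2 D} {d : L2 D}
    (h : ∀ v ∈ H10 D, vecInner D (grad D v) E = -inner ℂ (v : L2 D) d) : HasDiv D E d := by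
  intro χ
  have := h _ (testToH1_mem_H10 χ)
  rw [grad_testToH1] at this
  exact this

theorem vcurl_mem_electricEigenspace {ω mu : ℝ} {ψ : H1 D} (hψ : ψ ∈ neumannEigenspace D mu) :
    vcurl D ψ ∈ electricEigenspace D ω ((ω : ℂ) ^ 2 - mu) := by
  refine ⟨(mu : ℂ) • ψ, 0, hasCurlZeroTrace_of_green fun v => ?_, hasDiv_vcurl ψ, zero_mem _, ?_⟩
  · rw [vecInner_vcurl_vcurl, hψ v, Submodule.coe_smul, inner_smul_right]
  · rw [eigenEquation_iff, map_smul, map_zero, sub_zero]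

theorem grad_mem_electricEigenspace {ω lam : ℝ} {φ : H1 D} (hφ : φ ∈ dirichletEigenspace D lam) :
    grad D φ ∈ electricEigenspace D ω ((ω : ℂ) ^ 2 - lam) := by
  refine ⟨0, -((lam : ℂ) • φ), ⟨hasCurl_grad φ, fun v => ?_⟩, hasDiv_of_green fun v hv => ?_,
    neg_mem (Submodule.smul_mem _ _ hφ.1), ?_⟩
  · rw [vecInner_vcurl_grad hφ.1]
    exact inner_zero_right _
  · rw [hφ.2 v hv, Submodule.coe_neg, Submodule.coe_smul, inner_neg_right, inner_smul_right,
      neg_neg]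
  · rw [eigenEquation_iff, map_neg, map_smul, map_zero, sub_neg_eq_add, zero_add]

/-- The electric eigenspaces away from `β² = ω²`: the eigenfield is recovered from its curl and
divergence, which are Neumann and Dirichlet eigenfunctions. -/
theorem electricEigenspace_eq_sup {ω mu : ℝ} (hmu : mu ≠ 0) :
    electricEigenspace D ω ((ω : ℂ) ^ 2 - mu) =
      (neumannEigenspace D mu).map (vcurl D) ⊔ (dirichletEigenspace D mu).map (grad D) := by
  apply le_antisymm
  · rintro E ⟨c, d, hc, hd, hd0, hE⟩
    rw [eigenEquation_iff] at hE
    have hmu' : (mu : ℂ) ≠ 0 := Complex.ofReal_ne_zero.2 hmu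
    have hcN : c ∈ neumannEigenspace D mu := neumann_of_electric hc hd0 hE
    have hdD : d ∈ dirichletEigenspace D mu :=
      ⟨hd0, fun v hv => dirichlet_of_electric hd hE hv⟩
    refine Submodule.mem_sup.2 ⟨_, Submodule.mem_map_of_mem (Submodule.smul_mem _ (mu : ℂ)⁻¹ hcN),
      _, Submodule.mem_map_of_mem (Submodule.smul_mem _ (-(mu : ℂ)⁻¹) hdD), ?_⟩
    rw [map_smul, map_smul, neg_smul, ← sub_eq_add_neg, ← smul_sub, ← hE, inv_smul_smul₀ hmu']
  · refine sup_le ?_ ?_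
    · rintro _ ⟨ψ, hψ, rfl⟩
      exact vcurl_mem_electricEigenspace hψ
    · rintro _ ⟨φ, hφ, rfl⟩
      exact grad_mem_electricEigenspace hφ

theorem eq_zero_of_mem_neumannEigenspace {mu : ℝ} (hmu : mu ≠ 0) {ψ : H1 D}
    (hψ : ψ ∈ neumannEigenspace D mu) (h : grad D ψ = 0) : ψ = 0 := by
  have h1 := hψ ψ
  rw [h, vecInner_zero, eq_comm, mul_eq_zero, Complex.ofReal_eq_zero] at h1
  exact Subtype.ext (inner_self_eq_zero.1 (h1.resolve_left hmu))

/-- The eigenvalues of the electric problem. -/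
theorem isElectricEigenvalue_iff (hbdd : Bornology.IsBounded (D : Set Plane))
    (hsc : SimplyConnectedSpace D) (ω : ℝ) (b : ℂ) : IsElectricEigenvalue D ω b ↔
      (∃ mu : ℝ, 0 < mu ∧ IsNeumannEigenvalue D mu ∧ b = (ω : ℂ) ^ 2 - mu) ∨
      (∃ lam : ℝ, IsDirichletEigenvalue D lam ∧ b = (ω : ℂ) ^ 2 - lam) := by
  constructor
  · obtain ⟨k, rfl⟩ : ∃ k, b = (ω : ℂ) ^ 2 - k := ⟨(ω : ℂ) ^ 2 - b, by ring⟩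
    intro hb
    have hk : k ≠ 0 := by
      rintro rfl
      exact hb (electricEigenspace_sq_eq_bot hbdd hsc ω)
    obtain ⟨E, ⟨c, d, hc, hd, hd0, hE⟩, hE0⟩ := Submodule.exists_mem_ne_zero_of_ne_bot hb
    rw [eigenEquation_iff] at hE
    by_cases hcz : c = 0
    · have hdz : d ≠ 0 := by
        rintro rfl
        rw [hcz, map_zero, map_zero, sub_zero] at hE
        exact hE0 ((smul_eq_zero.1 hE).resolve_left hk)
      obtain ⟨m, -, rfl⟩ := exists_eq_ofReal_of_rayleigh hdz (dirichlet_of_electric hd hE hd0)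
      exact Or.inr ⟨m, Submodule.ne_bot_iff _ |>.2
        ⟨d, ⟨hd0, fun v hv => dirichlet_of_electric hd hE hv⟩, hdz⟩, rfl⟩
    · obtain ⟨m, hm, rfl⟩ := exists_eq_ofReal_of_rayleigh hcz (neumann_of_electric hc hd0 hE c)
      exact Or.inl ⟨m, lt_of_le_of_ne hm fun h => hk (by rw [← h, Complex.ofReal_zero]),
        Submodule.ne_bot_iff _ |>.2 ⟨c, neumann_of_electric hc hd0 hE, hcz⟩, rfl⟩
  · rintro (⟨mu, hmu, h, rfl⟩ | ⟨lam, h, rfl⟩)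
    · obtain ⟨ψ, hψ, hne⟩ := Submodule.exists_mem_ne_zero_of_ne_bot h
      exact (Submodule.ne_bot_iff _).2 ⟨vcurl D ψ, vcurl_mem_electricEigenspace hψ, fun h0 =>
        hne (eq_zero_of_mem_neumannEigenspace hmu.ne' hψ (vcurl_eq_zero_iff.1 h0))⟩
    · obtain ⟨φ, hφ, hne⟩ := Submodule.exists_mem_ne_zero_of_ne_bot h
      exact (Submodule.ne_bot_iff _).2 ⟨grad D φ, grad_mem_electricEigenspace hφ, fun h0 =>
        hne (eq_zero_of_mem_H10_of_grad_eq_zero hbdd hφ.1 h0)⟩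

/-! ### The magnetic eigenspaces -/

/-- The pointwise rotation `(E₁, E₂) ↦ (-E₂, E₁)` of vector fields by a right angle. -/
def rotation (D : Opens Plane) : VecL2 D ≃ₗ[ℂ] VecL2 D where
  toFun E := ![-E 1, E 0]
  invFun E := ![E 1, -E 0]
  map_add' E F := by
    funext i
    fin_cases i
    · exact neg_add _ _
    · rfl
  map_smul' a E := by
    funext i
    fin_cases i
    · exact (smul_neg a (E 1)).symm
    · rfl
  left_inv E := by
    funext i
    fin_cases i
    · rfl
    · exact neg_neg _
  right_inv E := by
    funext i
    fin_cases i
    · exact neg_neg _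
    · rfl

@[simp] theorem rotation_zero (E : VecL2 D) : rotation D E 0 = -E 1 := rfl
@[simp] theorem rotation_one (E : VecL2 D) : rotation D E 1 = E 0 := rfl

theorem rotation_vcurl (u : H1 D) : rotation D (vcurl D u) = grad D u := by
  funext i
  fin_cases i
  · exact neg_neg _
  · rfl

theorem rotation_grad (u : H1 D) : rotation D (grad D u) = -vcurl D u := by
  funext i
  fin_cases i
  · rfl
  · exact (neg_neg _).symm

theorem vecInner_grad_rotation (v : H1 D) (E : VecL2 D) :
    vecInner D (grad D v) (rotation D E) = vecInner D (vcurl D v) E := by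
  simp only [vecInner, grad_zero, grad_one, vcurl_zero, vcurl_one, rotation_zero, rotation_one,
    inner_neg_left, inner_neg_right]
  ring

theorem hasCurl_rotation {E : VecL2 D} {d : L2 D} : HasCurl D (rotation D E) d ↔ HasDiv D E d := by
  refine forall_congr' fun χ => ?_
  rw [rotation_zero, rotation_one, inner_neg_right]
  constructor <;> intro h <;> linear_combination -h

theorem hasDivZeroTrace_rotation {E : VecL2 D} {c : L2 D} :
    HasDivZeroTrace D (rotation D E) (-c) ↔ HasCurlZeroTrace D E c := by
  refine and_congr (forall_congr' fun χ => ?_) (forall_congr' fun v => ?_)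
  · rw [rotation_zero, rotation_one, inner_neg_right, inner_neg_right, neg_neg]
    constructor <;> intro h <;> linear_combination h
  · rw [vecInner_grad_rotation, inner_neg_right, neg_inj]

/-- The magnetic eigenfields are the rotated electric eigenfields. -/
theorem rotation_mem_magneticEigenspace {ω : ℝ} {b : ℂ} {E : VecL2 D} :
    rotation D E ∈ magneticEigenspace D ω b ↔ E ∈ electricEigenspace D ω b := by
  obtain ⟨k, rfl⟩ : ∃ k, b = (ω : ℂ) ^ 2 - k := ⟨(ω : ℂ) ^ 2 - b, by ring⟩
  have heq (c d : H1 D) : k • rotation D E = vcurl D d - grad D (-c) ↔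
      k • E = vcurl D c - grad D d := by
    rw [← (rotation D).injective.eq_iff (a := k • E), map_smul, map_sub, rotation_vcurl,
      rotation_grad, map_neg, sub_neg_eq_add, sub_neg_eq_add, add_comm]
  constructor
  · rintro ⟨d, c, hd, hd0, hc, hE⟩
    rw [eigenEquation_iff, ← neg_neg c, heq] at hE
    rw [← neg_neg c, Submodule.coe_neg, hasDivZeroTrace_rotation] at hc
    exact ⟨-c, d, hc, hasCurl_rotation.1 hd, hd0, eigenEquation_iff.2 hE⟩
  · rintro ⟨c, d, hc, hd, hd0, hE⟩
    refine ⟨d, -c, hasCurl_rotation.2 hd, hd0, ?_, ?_⟩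
    · rw [Submodule.coe_neg]
      exact hasDivZeroTrace_rotation.2 hc
    · rw [eigenEquation_iff] at hE ⊢
      exact (heq c d).2 hE

theorem vecInner_grad_vcurl_of_mem_right {v : H1 D} (hv : v ∈ H10 D) (u : H1 D) :
    vecInner D (grad D u) (vcurl D v) = 0 := by
  rw [vecInner_eq_zero_comm, ← vecInner_grad_rotation, rotation_grad, ← neg_one_smul ℂ,
    vecInner_smul, vecInner_grad_vcurl hv, mul_zero]

theorem magneticEigenspace_eq_map (ω : ℝ) (b : ℂ) :
    magneticEigenspace D ω b =
      (electricEigenspace D ω b).map (rotation D : VecL2 D →ₗ[ℂ] VecL2 D) := by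
  ext H
  obtain ⟨E, rfl⟩ := (rotation D).surjective H
  rw [rotation_mem_magneticEigenspace]
  exact ((rotation D).injective.mem_set_image (s := (electricEigenspace D ω b : Set (VecL2 D)))).symm

theorem isMagneticEigenvalue_iff_isElectricEigenvalue (ω : ℝ) (b : ℂ) :
    IsMagneticEigenvalue D ω b ↔ IsElectricEigenvalue D ω b := by
  rw [IsMagneticEigenvalue, magneticEigenspace_eq_map, IsElectricEigenvalue, Ne, Ne,
    Submodule.map_eq_bot_iff]

theorem magneticEigenspace_eq_sup {ω mu : ℝ} (hmu : mu ≠ 0) :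
    magneticEigenspace D ω ((ω : ℂ) ^ 2 - mu) =
      (neumannEigenspace D mu).map (grad D) ⊔ (dirichletEigenspace D mu).map (vcurl D) := by
  have h1 : (rotation D : VecL2 D →ₗ[ℂ] VecL2 D) ∘ₗ vcurl D = grad D :=
    LinearMap.ext rotation_vcurl
  have h2 : (rotation D : VecL2 D →ₗ[ℂ] VecL2 D) ∘ₗ grad D = -vcurl D :=
    LinearMap.ext rotation_grad
  rw [magneticEigenspace_eq_map, electricEigenspace_eq_sup hmu, Submodule.map_sup,
    ← Submodule.map_comp, ← Submodule.map_comp, h1, h2, Submodule.map_neg]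

/-! ### Multiplicities -/

theorem rank_map_of_eq_zero {M N : Type} [AddCommGroup M] [Module ℂ M] [AddCommGroup N]
    [Module ℂ N] (f : M →ₗ[ℂ] N) (S : Submodule ℂ M) (h : ∀ x ∈ S, f x = 0 → x = 0) :
    Module.rank ℂ (S.map f) = Module.rank ℂ S := by
  have hinj : Function.Injective (f.domRestrict S) :=
    (injective_iff_map_eq_zero _).2 fun x hx => Subtype.ext (h x x.2 hx)
  rw [← LinearMap.range_domRestrict]
  exact (LinearEquiv.ofInjective _ hinj).rank_eq.symm

/-- If the eigenspaces `S` for `β² = ω² - mu` are sums of the images of the Neumann and Dirichlet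
eigenspaces under two differential operators that are injective on them and have independent
ranges, the three cases for eigenspaces and multiplicities follow. -/
theorem eigenspaces_of_eq_sup (hbdd : Bornology.IsBounded (D : Set Plane))
    {S : ℂ → Submodule ℂ (VecL2 D)} {f g : H1 D →ₗ[ℂ] VecL2 D} {ω : ℝ}
    (hS : ∀ mu : ℝ, mu ≠ 0 → S ((ω : ℂ) ^ 2 - mu) =
      (neumannEigenspace D mu).map f ⊔ (dirichletEigenspace D mu).map g)
    (hf : ∀ u, f u = 0 → grad D u = 0) (hg : ∀ u, g u = 0 → grad D u = 0)
    (hfg : ∀ u, ∀ v ∈ H10 D, vecInner D (f u) (g v) = 0) :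
    (∀ mu : ℝ, 0 < mu → IsNeumannEigenvalue D mu → ¬ IsDirichletEigenvalue D mu →
      S ((ω : ℂ) ^ 2 - mu) = (neumannEigenspace D mu).map f ∧
      Module.rank ℂ (S ((ω : ℂ) ^ 2 - mu)) = Module.rank ℂ (neumannEigenspace D mu)) ∧
    (∀ lam : ℝ, IsDirichletEigenvalue D lam → ¬ IsNeumannEigenvalue D lam →
      S ((ω : ℂ) ^ 2 - lam) = (dirichletEigenspace D lam).map g ∧
      Module.rank ℂ (S ((ω : ℂ) ^ 2 - lam)) = Module.rank ℂ (dirichletEigenspace D lam)) ∧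
    (∀ mu lam : ℝ, IsNeumannEigenvalue D mu → IsDirichletEigenvalue D lam → mu = lam →
      S ((ω : ℂ) ^ 2 - mu) =
        (neumannEigenspace D mu).map f ⊔ (dirichletEigenspace D lam).map g ∧
      Module.rank ℂ (S ((ω : ℂ) ^ 2 - mu)) =
        Module.rank ℂ (neumannEigenspace D mu) + Module.rank ℂ (dirichletEigenspace D lam)) := by
  have hN (mu : ℝ) (hmu : mu ≠ 0) : Module.rank ℂ ((neumannEigenspace D mu).map f) =
      Module.rank ℂ (neumannEigenspace D mu) :=
    rank_map_of_eq_zero f _ fun u hu h0 => eq_zero_of_mem_neumannEigenspace hmu hu (hf u h0)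
  have hD (lam : ℝ) : Module.rank ℂ ((dirichletEigenspace D lam).map g) =
      Module.rank ℂ (dirichletEigenspace D lam) :=
    rank_map_of_eq_zero g _ fun u hu h0 =>
      eq_zero_of_mem_H10_of_grad_eq_zero hbdd hu.1 (hg u h0)
  refine ⟨fun mu hmu _ hnD => ?_, fun lam hlam hnN => ?_, ?_⟩
  · have h : S ((ω : ℂ) ^ 2 - mu) = (neumannEigenspace D mu).map f := by
      rw [hS mu hmu.ne', not_not.1 hnD, Submodule.map_bot, sup_bot_eq]
    exact ⟨h, by rw [h, hN mu hmu.ne']⟩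
  · have h : S ((ω : ℂ) ^ 2 - lam) = (dirichletEigenspace D lam).map g := by
      rw [hS lam (dirichletEigenvalue_pos hbdd hlam).ne', not_not.1 hnN, Submodule.map_bot,
        bot_sup_eq]
    exact ⟨h, by rw [h, hD]⟩
  · rintro mu _ - hlam rfl
    have hmu := (dirichletEigenvalue_pos hbdd hlam).ne'
    refine ⟨hS mu hmu, ?_⟩
    have hdisj : (neumannEigenspace D mu).map f ⊓ (dirichletEigenspace D mu).map g = ⊥ := by
      refine (Submodule.eq_bot_iff _).2 ?_
      rintro _ ⟨⟨u, -, hu⟩, ⟨v, hv, rfl⟩⟩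
      have := hfg u v hv.1
      rw [hu] at this
      exact vecInner_self_eq_zero.1 this
    have := Submodule.rank_sup_add_rank_inf_eq ((neumannEigenspace D mu).map f)
      ((dirichletEigenspace D mu).map g)
    rw [hdisj, rank_bot, add_zero, hN mu hmu, hD] at this
    rw [hS mu hmu, this]

end Waveguide

end

theorem mainTheorem10 (D : TopologicalSpace.Opens Plane)
    (hbdd : Bornology.IsBounded (D : Set Plane)) (hsc : SimplyConnectedSpace D)
    (ω : ℝ) (hω : 0 < ω) :
    -- the electric eigenproblem
    ((∀ b : ℂ, IsElectricEigenvalue D ω b ↔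
        (∃ mu : ℝ, 0 < mu ∧ IsNeumannEigenvalue D mu ∧ b = (ω : ℂ) ^ 2 - mu) ∨
        (∃ lam : ℝ, IsDirichletEigenvalue D lam ∧ b = (ω : ℂ) ^ 2 - lam)) ∧
      (∀ mu : ℝ, 0 < mu → IsNeumannEigenvalue D mu → ¬ IsDirichletEigenvalue D mu →
        electricEigenspace D ω ((ω : ℂ) ^ 2 - mu) = (neumannEigenspace D mu).map (vcurl D) ∧
        Module.rank ℂ (electricEigenspace D ω ((ω : ℂ) ^ 2 - mu)) =
          Module.rank ℂ (neumannEigenspace D mu)) ∧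
      (∀ lam : ℝ, IsDirichletEigenvalue D lam → ¬ IsNeumannEigenvalue D lam →
        electricEigenspace D ω ((ω : ℂ) ^ 2 - lam) = (dirichletEigenspace D lam).map (grad D) ∧
        Module.rank ℂ (electricEigenspace D ω ((ω : ℂ) ^ 2 - lam)) =
          Module.rank ℂ (dirichletEigenspace D lam)) ∧
      (∀ mu lam : ℝ, IsNeumannEigenvalue D mu → IsDirichletEigenvalue D lam → mu = lam →
        electricEigenspace D ω ((ω : ℂ) ^ 2 - mu) =
          (neumannEigenspace D mu).map (vcurl D) ⊔ (dirichletEigenspace D lam).map (grad D) ∧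
        Module.rank ℂ (electricEigenspace D ω ((ω : ℂ) ^ 2 - mu)) =
          Module.rank ℂ (neumannEigenspace D mu) + Module.rank ℂ (dirichletEigenspace D lam))) ∧
    -- the magnetic eigenproblem
    ((∀ b : ℂ, IsMagneticEigenvalue D ω b ↔
        (∃ mu : ℝ, 0 < mu ∧ IsNeumannEigenvalue D mu ∧ b = (ω : ℂ) ^ 2 - mu) ∨
        (∃ lam : ℝ, IsDirichletEigenvalue D lam ∧ b = (ω : ℂ) ^ 2 - lam)) ∧
      (∀ mu : ℝ, 0 < mu → IsNeumannEigenvalue D mu → ¬ IsDirichletEigenvalue D mu →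
        magneticEigenspace D ω ((ω : ℂ) ^ 2 - mu) = (neumannEigenspace D mu).map (grad D) ∧
        Module.rank ℂ (magneticEigenspace D ω ((ω : ℂ) ^ 2 - mu)) =
          Module.rank ℂ (neumannEigenspace D mu)) ∧
      (∀ lam : ℝ, IsDirichletEigenvalue D lam → ¬ IsNeumannEigenvalue D lam →
        magneticEigenspace D ω ((ω : ℂ) ^ 2 - lam) = (dirichletEigenspace D lam).map (vcurl D) ∧
        Module.rank ℂ (magneticEigenspace D ω ((ω : ℂ) ^ 2 - lam)) =
          Module.rank ℂ (dirichletEigenspace D lam)) ∧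
      (∀ mu lam : ℝ, IsNeumannEigenvalue D mu → IsDirichletEigenvalue D lam → mu = lam →
        magneticEigenspace D ω ((ω : ℂ) ^ 2 - mu) =
          (neumannEigenspace D mu).map (grad D) ⊔ (dirichletEigenspace D lam).map (vcurl D) ∧
        Module.rank ℂ (magneticEigenspace D ω ((ω : ℂ) ^ 2 - mu)) =
          Module.rank ℂ (neumannEigenspace D mu) +
            Module.rank ℂ (dirichletEigenspace D lam))) := by
  refine ⟨⟨isElectricEigenvalue_iff hbdd hsc ω, ?_⟩, fun b => ?_, ?_⟩
  · exact eigenspaces_of_eq_sup hbdd (fun _ => electricEigenspace_eq_sup)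
      (fun _ => vcurl_eq_zero_iff.1) (fun _ => id) fun u _ hv => vecInner_vcurl_grad hv u
  · rw [isMagneticEigenvalue_iff_isElectricEigenvalue]
    exact isElectricEigenvalue_iff hbdd hsc ω b
  · exact eigenspaces_of_eq_sup hbdd (fun _ => magneticEigenspace_eq_sup) (fun _ => id)
      (fun _ => vcurl_eq_zero_iff.1) fun u _ hv => vecInner_grad_vcurl_of_mem_right hv u
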